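/- Let $G$ be an amenable locally compact (Hausdorff) group with a left Haar measure $\lambda$, let $(\Omega,\mu)$ be a measure space, let $1\le p<\infty$, and let all $L^p$-spaces be taken over the same scalar field, $\mathbb{R}$ or $\mathbb{C}$. Let $\pi$ be a strongly continuous, uniformly bounded representation of $G$ on $L^p(\Omega,\mu)$ by separation-preserving operators; that is, $\pi$ is a group homomorphism from $G$ into the invertible bounded operators on $L^p(\Omega,\mu)$ such that - $x\mapsto\pi(x)h$ is norm continuous for every $h\in L^p(\Omega,\mu)$, - $\sup_{x\in G}\|\pi(x)\|<\infty$, - for every $x\in G$ and all $f,g\in L^p(\Omega,\mu)$, $f\cdot g=0$ $\mu$-a.e. implies $\pi(x)f\cdot\pi(x)g=0$ $\mu$-a.e. For $k\in L^1(G,\lambda)$, $f\in L^p(G,\lambda)$ and $h\in L^p(\Omega,\mu)$ put $$(k\star f)(x)=\int_G k(y)f(y^{-1}x)\,d\lambda(y),\qquad \pi(k)h=\int_G k(x)\,\pi(x)h\,d\lambda(x),$$ the latter being an absolutely convergent $L^p(\Omega,\mu)$-valued integral. Let $k_1,k_2,\ldots$ be a sequence in $L^1(G,\lambda)$ and define the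 maximal functions $$m(f)(x)=\sup_{i}|(k_i\star f)(x)|,\qquad M(h)(\omega)=\sup_i|(\pi(k_i)h)(\omega)|.$$ Suppose that ${\rm m}_k\ge 0$ is a constant such that $$\|m(f)\|_{L^p(G,\lambda)}\le {\rm m}_k\,\|f\|_{L^p(G,\lambda)}\qquad\text{for all } f\in L^p(G,\lambda).$$ Then $$\|M(h)\|_{L^p(\Omega,\mu)}\le {\rm m}_k\,\sup_{y\in G}\|\pi(y)\|^2\,\|h\|_{L^p(\Omega,\mu)}\qquad\text{for all } h\in L^p(\Omega,\mu).$$ -/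

import Mathlib

open MeasureTheory
open scoped ENNReal NNReal BoundedContinuousFunction

/-- A topological group is amenable if the bounded continuous real functions on it carry a
left-invariant mean: a positive normalised linear functional `m` with `m (f (g ·)) = m f`. For a
locally compact group this is equivalent to a left-invariant mean on `L^∞`. -/
def IsAmenableGroup (G : Type*) [Group G] [TopologicalSpace G] [IsTopologicalGroup G] : Prop :=
  ∃ m : (G →ᵇ ℝ) →ₗ[ℝ] ℝ,
    (∀ f : G →ᵇ ℝ, (∀ x, 0 ≤ f x) → 0 ≤ m f) ∧
    m (BoundedContinuousFunction.const G 1) = 1 ∧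
    ∀ (g : G) (f : G →ᵇ ℝ), m (f.compContinuous (ContinuousMap.mulLeft g)) = m f

/-- `R` preserves separation: `f · g = 0` implies `R f · R g = 0` (almost everywhere). -/
def SeparationPreserving {Ω 𝕜 : Type*} [RCLike 𝕜] [MeasurableSpace Ω] {μ : Measure Ω}
    {p : ℝ≥0∞} [Fact (1 ≤ p)] (R : Lp 𝕜 p μ →L[𝕜] Lp 𝕜 p μ) : Prop :=
  ∀ f g : Lp 𝕜 p μ, (∀ᵐ ω ∂μ, f ω * g ω = 0) → ∀ᵐ ω ∂μ, R f ω * R g ω = 0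

/-- A separation preserving representation: a homomorphism of `G` into the invertible bounded
operators on `L^p` that is strongly continuous and uniformly bounded, and all of whose operators
preserve separation. (A monoid homomorphism sends the group `G` to invertible operators.) -/
structure IsSeparationPreservingRep {G Ω 𝕜 : Type*} [RCLike 𝕜] [Group G] [TopologicalSpace G]
    [MeasurableSpace Ω] {μ : Measure Ω} {p : ℝ≥0∞} [Fact (1 ≤ p)]
    (π : G →* (Lp 𝕜 p μ →L[𝕜] Lp 𝕜 p μ)) : Prop where
  strongly_continuous : ∀ h : Lp 𝕜 p μ, Continuous fun x => π x h
  uniformly_bounded : ∃ C : ℝ, ∀ x, ‖π x‖ ≤ C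
  separation_preserving : ∀ x, SeparationPreserving (π x)

/-- The convolution product `(k ⋆ f)(x) = ∫ k(y) f(y⁻¹ x) dν(y)`. -/
noncomputable def groupConv {G 𝕜 : Type*} [RCLike 𝕜] [Group G] [MeasurableSpace G]
    (ν : Measure G) (k f : G → 𝕜) (x : G) : 𝕜 :=
  ∫ y, k y * f (y⁻¹ * x) ∂ν

/-- The integrated representation `π(k) h = ∫ k(x) π(x) h dν(x)`, an `L^p`-valued integral. -/
noncomputable def integratedRep {G Ω 𝕜 : Type*} [RCLike 𝕜] [Group G] [MeasurableSpace G]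
    [MeasurableSpace Ω] {μ : Measure Ω} {p : ℝ≥0∞} [Fact (1 ≤ p)] (ν : Measure G)
    (π : G →* (Lp 𝕜 p μ →L[𝕜] Lp 𝕜 p μ)) (k : G → 𝕜) (h : Lp 𝕜 p μ) : Lp 𝕜 p μ :=
  ∫ x, k x • π x h ∂ν

/-- The maximal function `m(f)(x) = sup_i |(k_i ⋆ f)(x)|`, with values in `[0, ∞]`. -/
noncomputable def convMaximal {G 𝕜 : Type*} [RCLike 𝕜] [Group G] [MeasurableSpace G]
    (ν : Measure G) (k : ℕ → G → 𝕜) (f : G → 𝕜) (x : G) : ℝ≥0∞ :=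
  ⨆ i, ‖groupConv ν (k i) f x‖ₑ

/-- The maximal function `M(h)(ω) = sup_i |(π(k_i) h)(ω)|`, with values in `[0, ∞]`. -/
noncomputable def repMaximal {G Ω 𝕜 : Type*} [RCLike 𝕜] [Group G] [MeasurableSpace G]
    [MeasurableSpace Ω] {μ : Measure Ω} {p : ℝ≥0∞} [Fact (1 ≤ p)] (ν : Measure G)
    (π : G →* (Lp 𝕜 p μ →L[𝕜] Lp 𝕜 p μ)) (k : ℕ → G → 𝕜) (h : Lp 𝕜 p μ) (ω : Ω) : ℝ≥0∞ :=
  ⨆ i, ‖integratedRep ν π (k i) h ω‖ₑ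

/-- The integral defining `π(k) h` converges absolutely for every integrable `k`. -/
theorem integrable_integratedRep {G Ω 𝕜 : Type*} [RCLike 𝕜] [Group G] [TopologicalSpace G]
    [IsTopologicalGroup G] [LocallyCompactSpace G] [T2Space G] [MeasurableSpace G] [BorelSpace G]
    (ν : Measure G) [ν.IsHaarMeasure] [ν.Regular] [MeasurableSpace Ω] {μ : Measure Ω}
    {p : ℝ≥0∞} [Fact (1 ≤ p)] {π : G →* (Lp 𝕜 p μ →L[𝕜] Lp 𝕜 p μ)}
    (hπ : IsSeparationPreservingRep π) {k : G → 𝕜} (hk : Integrable k ν) (h : Lp 𝕜 p μ) :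
    Integrable (fun x => k x • π x h) ν := by
  obtain ⟨C, hC⟩ := hπ.uniformly_bounded
  have hcont := hπ.strongly_continuous h
  have hfin : ∀ s, MeasurableSet s → ν s ≠ ∞ →
      AEStronglyMeasurable (fun x => π x h) (ν.restrict s) := by
    intro s hs hsf
    have hex : ∀ n : ℕ, ∃ K ⊆ s, IsCompact K ∧ ν (s \ K) < ((n : ℝ≥0∞) + 1)⁻¹ := fun n =>
      hs.exists_isCompact_sdiff_lt hsf (ENNReal.inv_ne_zero.2 (by finiteness))
    choose K hKs hK hKn using hex
    have hnull : ν (s \ ⋃ n, K n) = 0 := by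
      refine le_antisymm (ge_of_tendsto' (x := Filter.atTop)
        (f := fun n : ℕ => ((n : ℝ≥0∞) + 1)⁻¹) ?_ fun n => ?_) zero_le
      · simpa using (Filter.tendsto_add_atTop_iff_nat 1).2 ENNReal.tendsto_inv_nat_nhds_zero
      · exact (measure_mono (Set.sdiff_subset_sdiff_right (Set.subset_iUnion K n))).trans (hKn n).le
    have hsK : (⋃ n, K n) =ᵐ[ν] s :=
      (Set.iUnion_subset hKs).eventuallyLE.antisymm (ae_le_set.2 hnull)
    rw [← Measure.restrict_congr_set hsK]
    exact (aestronglyMeasurable_iUnion_iff).2 fun n =>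
      hcont.continuousOn.aestronglyMeasurable_of_isCompact (hK n) (hK n).measurableSet
  have key : AEStronglyMeasurable (fun x => k x • π x h) ν := by
    obtain ⟨t, ht, hkt, hσ⟩ := hk.aefinStronglyMeasurable.exists_set_sigmaFinite
    have h1 : AEStronglyMeasurable (fun x => π x h) (ν.restrict t) := by
      rw [← Measure.restrict_univ (μ := ν.restrict t), ← iUnion_spanningSets (ν.restrict t)]
      refine (aestronglyMeasurable_iUnion_iff).2 fun n => ?_
      have hm := measurableSet_spanningSets (ν.restrict t) n
      rw [Measure.restrict_restrict hm]
      refine hfin _ (hm.inter ht) ?_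
      rw [← Measure.restrict_apply hm]
      exact (measure_spanningSets_lt_top _ n).ne
    have h2 := (aestronglyMeasurable_indicator_iff ht).2
      (hk.aestronglyMeasurable.restrict.smul h1)
    refine h2.congr ?_
    filter_upwards [(ae_restrict_iff' ht.compl).1 hkt] with x hx
    by_cases hxt : x ∈ t
    · simp [hxt]
    · have : k x = 0 := by simpa using hx hxt
      simp [hxt, this]
  refine (hk.norm.mul_const (C * ‖h‖)).mono' key (Filter.Eventually.of_forall fun x => ?_)
  rw [norm_smul]
  gcongr
  exact ((π x).le_opNorm h).trans (by gcongr; exact hC x)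

/-!
The proof transfers the maximal inequality from the left translations of `G` to the representation
`π`. Write `C` for the supremum of the norms `‖π(y)‖`. By monotone convergence it suffices to
bound the maximal function of the first `N` kernels, which is the pointwise norm of a function
with values in `𝕜^N` with the sup norm (`lpTuple`).

* A separation-preserving operator `R` preserves domination: `|e| ≤ |g|` implies `|R e| ≤ |R g|`
  (`SeparationPreserving.norm_apply_le`). Applied to `g = max_i |e_i|` this gives
  `‖max_i |R e_i|‖ ≤ ‖R‖ ‖max_i |e_i|‖` (`SeparationPreserving.norm_lpTuple_le`).

* For an amenable group and every `p < ∞` there are weights `g ≥ 0`, continuous with compact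
  support and of norm `1` in `L^p(G)`, that are moved arbitrarily little by the translations from
  a given compact set (`exists_almostInvariant`). To obtain them, let `m` be a left-invariant mean
  on bounded continuous functions. For fixed `u ≥ 0` the functional
  `φ ↦ m (∫ φ(y) u(y⁻¹ ·) dν(y))` on `C_c(G)` is positive and left invariant, so uniqueness
  of Haar measure makes it a multiple of the Haar integral
  (`mean_translateAverage_eq_of_nonneg`). A Hahn–Banach separation
  turns this topological invariance into elements of `L¹(G)` that are almost invariant in norm
  (`exists_norm_smoothing_lt`), uniformly on compact sets after smoothing
  (`exists_norm_leftTranslation_sub_le`). A `p`-th root brings them to `L^p(G)`.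

* The maximal inequality holds with the same constant for functions on `G` with values in `L^p(Ω)`
  (`norm_convTuple_le`). For a finite sum of tensors `f ⊗ e` with `f ∈ C_c(G)` and `e` simple it
  is the scalar inequality integrated over `Ω`; such sums are dense. Neither `G` nor `Ω` is
  assumed `σ`-finite, and restricting to these sums is what makes Tonelli's theorem available.

* The orbit map `h ↦ (x ↦ g(x) π(x⁻¹) h)` into `L^p(G; L^p(Ω))` has norm at most `C`, and for an
  almost invariant weight it almost intertwines `π(k_i)` with convolution by `k_i`
  (`norm_orbitMap_integratedRep_sub_convOp_le`). Conversely, applying `π(x)` at each point `x` and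
  using the domination property, the maximal function of `π(k_i) h` is bounded by `C` times that
  of the orbit maps of `π(k_i) h` (`norm_lpTuple_mul_le`). The maximal inequality lies between
  these two steps, each of which costs one factor `C`; together they give `mk * C ^ 2`.
-/

open Filter Topology
open scoped Pointwise CompactlySupported

/-! ### Separation-preserving operators preserve domination -/

section Domination

variable {Ω 𝕜 : Type*} [RCLike 𝕜] [MeasurableSpace Ω] {μ : Measure Ω} {p : ℝ≥0∞} [Fact (1 ≤ p)]

/-- A pointwise bound on the image under `R` passes to `L^p` limits, by convergence almost
everywhere along a subsequence. -/
theorem isClosed_setOf_ae_norm_le (R : Lp 𝕜 p μ →L[𝕜] Lp 𝕜 p μ) (b : Ω → ℝ) :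
    IsClosed {e : Lp 𝕜 p μ | ∀ᵐ ω ∂μ, ‖R e ω‖ ≤ b ω} := by
  refine IsSeqClosed.isClosed fun e e₀ he hlim => ?_
  have h1 : TendstoInMeasure μ (fun n => R (e n)) atTop (R e₀) :=
    tendstoInMeasure_of_tendsto_Lp ((R.continuous.tendsto e₀).comp hlim)
  obtain ⟨ns, -, hns⟩ := h1.exists_seq_tendsto_ae
  filter_upwards [hns, ae_all_iff.2 he] with ω h2 h3
  exact le_of_tendsto h2.norm (Eventually.of_forall fun n => h3 _)

/-- The image of `1_A g` and of `1_B g`, for disjoint `A` and `B`, have disjoint supports; so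
multiplying `g` by a simple function bounded by `1` can only decrease the modulus of its image. -/
theorem SeparationPreserving.norm_apply_simpleFunc_smul_le {R : Lp 𝕜 p μ →L[𝕜] Lp 𝕜 p μ}
    (hR : SeparationPreserving R) (g : Lp 𝕜 p μ) (s : SimpleFunc Ω 𝕜) (hs : ∀ ω, ‖s ω‖ ≤ 1)
    {e : Lp 𝕜 p μ} (he : e =ᵐ[μ] fun ω => s ω * g ω) :
    ∀ᵐ ω ∂μ, ‖R e ω‖ ≤ ‖R g ω‖ := by
  classical
  -- `P c` is the part of `g` living where `s = c`
  have hpc : ∀ c : 𝕜, MemLp ((s ⁻¹' {c}).indicator g) p μ := fun c =>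
    (Lp.memLp g).indicator (s.measurableSet_fiber c)
  set P : 𝕜 → Lp 𝕜 p μ := fun c => (hpc c).toLp _ with hP
  have hPc : ∀ c, P c =ᵐ[μ] (s ⁻¹' {c}).indicator g := fun c => (hpc c).coeFn_toLp
  have hcoe : ∀ a : 𝕜 → 𝕜, ((∑ c ∈ s.range, a c • P c : Lp 𝕜 p μ) : Ω → 𝕜) =ᵐ[μ]
      fun ω => a (s ω) * g ω := by
    intro a
    have h1 : ∀ᵐ ω ∂μ, ∀ c ∈ s.range, (a c • P c : Lp 𝕜 p μ) ω =
        a c * (s ⁻¹' {c}).indicator g ω := by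
      refine (Finset.eventually_all _).2 fun c _ => ?_
      filter_upwards [Lp.coeFn_smul (a c) (P c), hPc c] with ω h2 h3
      rw [h2, Pi.smul_apply, h3, smul_eq_mul]
    filter_upwards [Lp.coeFn_finsetSum s.range fun c => a c • P c, h1] with ω h2 h3
    rw [h2, Finset.sum_apply, Finset.sum_congr rfl h3,
      Finset.sum_eq_single_of_mem (s ω) (s.mem_range_self ω)]
    · simp
    · intro c _ hc
      rw [Set.indicator_of_notMem, mul_zero]
      exact fun h => hc h.symm
  have hg : g = ∑ c ∈ s.range, P c := by
    refine Lp.ext ?_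
    have := hcoe fun _ => 1
    simp only [one_smul, one_mul] at this
    exact this.symm
  have hes : e = ∑ c ∈ s.range, c • P c := Lp.ext (he.trans (hcoe id).symm)
  have hdisj : ∀ᵐ ω ∂μ, ∀ c ∈ s.range, ∀ d ∈ s.range, c ≠ d → R (P c) ω * R (P d) ω = 0 := by
    refine (Finset.eventually_all _).2 fun c _ => (Finset.eventually_all _).2 fun d _ => ?_
    by_cases hcd : c = d
    · exact Eventually.of_forall fun ω h => (h hcd).elim
    filter_upwards [hR (P c) (P d) (by
      filter_upwards [hPc c, hPc d] with ω h1 h2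
      rw [h1, h2]
      by_cases hω : s ω = c
      · rw [Set.indicator_of_notMem (s := s ⁻¹' {d}), mul_zero]
        exact fun h => hcd (hω.symm.trans h)
      · rw [Set.indicator_of_notMem (s := s ⁻¹' {c}), zero_mul]
        exact hω)] with ω hω _ using hω
  have hcoeR : ∀ a : 𝕜 → 𝕜, ((R (∑ c ∈ s.range, a c • P c) : Lp 𝕜 p μ) : Ω → 𝕜) =ᵐ[μ]
      fun ω => ∑ c ∈ s.range, a c * R (P c) ω := by
    intro a
    rw [map_sum]
    have h1 : ∀ᵐ ω ∂μ, ∀ c ∈ s.range, (R (a c • P c) : Lp 𝕜 p μ) ω = a c * R (P c) ω := by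
      refine (Finset.eventually_all _).2 fun c _ => ?_
      rw [map_smul]
      filter_upwards [Lp.coeFn_smul (a c) (R (P c))] with ω h2
      rw [h2, Pi.smul_apply, smul_eq_mul]
    filter_upwards [Lp.coeFn_finsetSum s.range fun c => R (a c • P c), h1] with ω h2 h3
    rw [h2, Finset.sum_apply, Finset.sum_congr rfl h3]
  have hR1 := hcoeR fun _ => 1
  simp only [one_smul, one_mul, ← hg] at hR1
  have hR2 := hcoeR id
  simp only [id, ← hes] at hR2
  filter_upwards [hdisj, hR1, hR2] with ω h1 h2 h3
  rw [h2, h3]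
  by_cases hall : ∀ c ∈ s.range, R (P c) ω = 0
  · rw [Finset.sum_eq_zero fun c hc => by rw [hall c hc, mul_zero], norm_zero]
    exact norm_nonneg _
  · -- at almost every `ω` at most one of the `R (P c)` is nonzero
    push Not at hall
    obtain ⟨c, hc, hcω⟩ := hall
    have hz : ∀ d ∈ s.range, d ≠ c → R (P d) ω = 0 := fun d hd hdc =>
      (mul_eq_zero.1 (h1 c hc d hd hdc.symm)).resolve_left hcω
    rw [Finset.sum_eq_single_of_mem c hc fun d hd hdc => by rw [hz d hd hdc, mul_zero],
      Finset.sum_eq_single_of_mem c hc hz, norm_mul]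
    obtain ⟨ω', rfl⟩ := SimpleFunc.mem_range.1 hc
    exact mul_le_of_le_one_left (norm_nonneg _) (hs ω')

/-- A separation-preserving operator has a modulus: it preserves domination of absolute values. -/
theorem SeparationPreserving.norm_apply_le (hp : p ≠ ∞) {R : Lp 𝕜 p μ →L[𝕜] Lp 𝕜 p μ}
    (hR : SeparationPreserving R) {e g : Lp 𝕜 p μ} (h : ∀ᵐ ω ∂μ, ‖e ω‖ ≤ ‖g ω‖) :
    ∀ᵐ ω ∂μ, ‖R e ω‖ ≤ ‖R g ω‖ := by
  have hp0 : p ≠ 0 := (zero_lt_one.trans_le Fact.out).ne'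
  have hem := (Lp.stronglyMeasurable e).measurable
  have hgm := (Lp.stronglyMeasurable g).measurable
  -- the quotient `e / g`, cut off where its modulus exceeds `1`
  set θ : Ω → 𝕜 := {ω | ‖e ω‖ ≤ ‖g ω‖}.indicator fun ω => e ω / g ω with hθ
  have hθm : Measurable θ := (hem.div hgm).indicator (measurableSet_le hem.norm hgm.norm)
  have hθ1 : ∀ ω, θ ω ∈ Metric.closedBall (0 : 𝕜) 1 := by
    intro ω
    rw [mem_closedBall_zero_iff, hθ]
    by_cases hω : ω ∈ {ω | ‖e ω‖ ≤ ‖g ω‖}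
    · rw [Set.indicator_of_mem hω, norm_div]
      exact div_le_one_of_le₀ hω (norm_nonneg _)
    · rw [Set.indicator_of_notMem hω, norm_zero]
      exact zero_le_one
  have hθe : ∀ᵐ ω ∂μ, e ω = θ ω * g ω := by
    filter_upwards [h] with ω hω
    rw [hθ, Set.indicator_of_mem (show ω ∈ {ω | ‖e ω‖ ≤ ‖g ω‖} from hω)]
    by_cases h0 : g ω = 0
    · rw [h0, norm_zero] at hω
      rw [h0, mul_zero]
      exact norm_le_zero_iff.1 hω
    · rw [div_mul_cancel₀ _ h0]
  set s : ℕ → SimpleFunc Ω 𝕜 := fun n =>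
    SimpleFunc.approxOn θ hθm (Metric.closedBall 0 1) 0 (by simp) n with hs
  have hs1 : ∀ n ω, ‖s n ω‖ ≤ 1 := fun n ω =>
    mem_closedBall_zero_iff.1 (SimpleFunc.approxOn_mem hθm _ n ω)
  have hslim : ∀ ω, Tendsto (fun n => s n ω) atTop (𝓝 (θ ω)) := fun ω =>
    SimpleFunc.tendsto_approxOn hθm _ (subset_closure (hθ1 ω))
  have hmem : ∀ n, MemLp (fun ω => s n ω * g ω) p μ := fun n =>
    (Lp.memLp g).of_le ((s n).aestronglyMeasurable.mul (Lp.aestronglyMeasurable g))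
      (Eventually.of_forall fun ω => by
        rw [norm_mul]; exact mul_le_of_le_one_left (norm_nonneg _) (hs1 n ω))
  have hlim : Tendsto (fun n => (hmem n).toLp _) atTop (𝓝 e) := by
    rw [Lp.tendsto_Lp_iff_tendsto_eLpNorm' (fun n => (hmem n).toLp _) e]
    have h0 : Tendsto (fun n => ∫⁻ ω, ‖(s n ω - θ ω) * g ω‖ₑ ^ p.toReal ∂μ) atTop (𝓝 0) := by
      have := tendsto_lintegral_of_dominated_convergence'
        (F := fun n ω => ‖(s n ω - θ ω) * g ω‖ₑ ^ p.toReal) (f := fun _ => 0) (μ := μ)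
        (fun ω => ‖(2 : 𝕜) * g ω‖ₑ ^ p.toReal) (fun n => ?_) (fun n => ?_) ?_ ?_
      · simpa using this
      · exact ((((s n).measurable.sub hθm).mul hgm).enorm.pow_const _).aemeasurable
      · refine Eventually.of_forall fun ω => ?_
        simp only [enorm_mul]
        gcongr
        rw [enorm_le_iff_norm_le, RCLike.norm_ofNat]
        exact (norm_sub_le _ _).trans (by
          have := hs1 n ω; have := mem_closedBall_zero_iff.1 (hθ1 ω); linarith)
      · have := ((Lp.memLp g).const_mul (2 : 𝕜)).eLpNorm_lt_top
        rw [eLpNorm_lt_top_iff_lintegral_rpow_enorm_lt_top hp0 hp] at this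
        exact this.ne
      · refine Eventually.of_forall fun ω => ?_
        have h1 : Tendsto (fun n => (s n ω - θ ω) * g ω) atTop (𝓝 0) := by
          simpa using ((hslim ω).sub_const (θ ω)).mul_const (g ω)
        have h2 := (ENNReal.continuous_rpow_const (y := p.toReal)).tendsto 0 |>.comp
          (by simpa using h1.enorm)
        simpa [Function.comp_def, ENNReal.zero_rpow_of_pos (ENNReal.toReal_pos hp0 hp)] using h2
    have h3 := ((ENNReal.continuous_rpow_const (y := 1 / p.toReal)).tendsto 0).comp h0
    rw [ENNReal.zero_rpow_of_pos (one_div_pos.2 (ENNReal.toReal_pos hp0 hp))] at h3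
    refine h3.congr fun n => ?_
    rw [Function.comp_apply, ← eLpNorm_eq_lintegral_rpow_enorm_toReal hp0 hp]
    refine eLpNorm_congr_ae ?_
    filter_upwards [(hmem n).coeFn_toLp, hθe] with ω h1 h2
    rw [Pi.sub_apply, h1, h2, sub_mul]
  exact (isClosed_setOf_ae_norm_le R _).mem_of_tendsto hlim (Eventually.of_forall fun n =>
    hR.norm_apply_simpleFunc_smul_le g (s n) (hs1 n) (hmem n).coeFn_toLp)

/-- The operator on tuples of `L^p` functions that applies `T` pointwise:
`(F₁, …, F_N) ↦ T (F₁ ·, …, F_N ·)`. -/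
noncomputable def lpCombine {α E Z : Type*} [MeasurableSpace α] {ν : Measure α}
    [NormedAddCommGroup E] [NormedSpace 𝕜 E] [NormedAddCommGroup Z] [NormedSpace 𝕜 Z] {N : ℕ}
    (T : (Fin N → E) →L[𝕜] Z) : (Fin N → Lp E p ν) →L[𝕜] Lp Z p ν :=
  ∑ i, (ContinuousLinearMap.compLpL p ν
    (T.comp (ContinuousLinearMap.single 𝕜 (fun _ : Fin N => E) i))).comp
      (ContinuousLinearMap.proj i)

theorem lpCombine_coeFn {α E Z : Type*} [MeasurableSpace α] {ν : Measure α} [NormedAddCommGroup E]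
    [NormedSpace 𝕜 E] [NormedAddCommGroup Z] [NormedSpace 𝕜 Z] {N : ℕ}
    (T : (Fin N → E) →L[𝕜] Z) (F : Fin N → Lp E p ν) :
    lpCombine T F =ᵐ[ν] fun x => T fun i => F i x := by
  have h1 : ∀ᵐ x ∂ν, ∀ i, (ContinuousLinearMap.compLpL p ν
      (T.comp (ContinuousLinearMap.single 𝕜 (fun _ : Fin N => E) i)) (F i)) x =
        T (Pi.single i (F i x)) :=
    ae_all_iff.2 fun i => ContinuousLinearMap.coeFn_compLpL _ (F i)
  have h2 : lpCombine T F = ∑ i, ContinuousLinearMap.compLpL p ν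
      (T.comp (ContinuousLinearMap.single 𝕜 (fun _ : Fin N => E) i)) (F i) := by
    simp [lpCombine]
  rw [h2]
  filter_upwards [h1, Lp.coeFn_finsetSum Finset.univ fun i => ContinuousLinearMap.compLpL p ν
      (T.comp (ContinuousLinearMap.single 𝕜 (fun _ : Fin N => E) i)) (F i)] with x h3 h4
  rw [h4, Finset.sum_apply]
  simp only [h3]
  rw [← map_sum, Finset.univ_sum_single]

/-- The element `ω ↦ (e₁ ω, …, e_N ω)` of `L^p(Ω; 𝕜^N)`, where `𝕜^N` carries the sup norm, so that
the norm of `lpTuple e` is the `L^p` norm of the maximal function `max_i |e_i|`. -/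
noncomputable def lpTuple {N : ℕ} : (Fin N → Lp 𝕜 p μ) →L[𝕜] Lp (Fin N → 𝕜) p μ :=
  lpCombine (ContinuousLinearMap.id 𝕜 (Fin N → 𝕜))

theorem lpTuple_coeFn {N : ℕ} (e : Fin N → Lp 𝕜 p μ) :
    lpTuple e =ᵐ[μ] fun ω i => e i ω := by
  filter_upwards [lpCombine_coeFn (ContinuousLinearMap.id 𝕜 (Fin N → 𝕜)) e] with ω hω
  rw [lpTuple, hω, ContinuousLinearMap.id_apply]

/-- The modulus of a separation-preserving operator bounds the maximal function of the images
by the image of the maximal function. -/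
theorem SeparationPreserving.norm_lpTuple_le (hp : p ≠ ∞) {R : Lp 𝕜 p μ →L[𝕜] Lp 𝕜 p μ}
    (hR : SeparationPreserving R) {N : ℕ} (e : Fin N → Lp 𝕜 p μ) :
    ‖lpTuple fun i => R (e i)‖ ≤ ‖R‖ * ‖lpTuple e‖ := by
  -- `g` is the maximal function of `e`
  have hmem : MemLp (fun ω => ((‖lpTuple e ω‖ : ℝ) : 𝕜)) p μ :=
    (Lp.memLp (lpTuple e)).norm.ofReal
  set g : Lp 𝕜 p μ := hmem.toLp _ with hg
  have hgn : ∀ᵐ ω ∂μ, ‖g ω‖ = ‖lpTuple e ω‖ := by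
    filter_upwards [hmem.coeFn_toLp] with ω hω
    rw [hω, RCLike.norm_ofReal, abs_norm]
  have hle : ∀ᵐ ω ∂μ, ∀ i, ‖R (e i) ω‖ ≤ ‖R g ω‖ := by
    refine ae_all_iff.2 fun i => hR.norm_apply_le hp ?_
    filter_upwards [hgn, lpTuple_coeFn e] with ω h1 h2
    rw [h1, h2]
    exact norm_le_pi_norm (fun i => e i ω) i
  calc ‖lpTuple fun i => R (e i)‖ ≤ ‖R g‖ := by
        refine Lp.norm_le_norm_of_ae_le ?_
        filter_upwards [hle, lpTuple_coeFn fun i => R (e i)] with ω h1 h2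
        rw [h2]
        exact (pi_norm_le_iff_of_nonneg (norm_nonneg _)).2 h1
    _ ≤ ‖R‖ * ‖g‖ := R.le_opNorm g
    _ = ‖R‖ * ‖lpTuple e‖ := by
        congr 1
        exact le_antisymm (Lp.norm_le_norm_of_ae_le (hgn.mono fun ω h => h.le))
          (Lp.norm_le_norm_of_ae_le (hgn.mono fun ω h => h.ge))

end Domination

/-! ### Invariant means are topologically invariant -/

section TopologicalInvariance

variable {G : Type*} [Group G] [TopologicalSpace G] [IsTopologicalGroup G]
  [MeasurableSpace G] [BorelSpace G]

theorem continuous_integral_mul_translate (ν : Measure G) [IsFiniteMeasureOnCompacts ν]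
    (φ : C_c(G, ℝ)) (u : G →ᵇ ℝ) : Continuous fun x => ∫ y, φ y * u (y⁻¹ * x) ∂ν := by
  rw [← continuousOn_univ]
  refine continuousOn_integral_of_compact_support (k := tsupport φ) φ.hasCompactSupport
    (Continuous.continuousOn ?_) fun x y _ hy => ?_
  · have := φ.continuous
    have := u.continuous
    simp only [Function.uncurry_def]
    fun_prop
  · rw [image_eq_zero_of_notMem_tsupport hy, zero_mul]

theorem integrable_mul_translate (ν : Measure G) [IsFiniteMeasureOnCompacts ν]
    (φ : C_c(G, ℝ)) (u : G →ᵇ ℝ) (x : G) : Integrable (fun y => φ y * u (y⁻¹ * x)) ν := by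
  have := φ.continuous
  have := u.continuous
  exact Continuous.integrable_of_hasCompactSupport (by fun_prop) φ.hasCompactSupport.mul_right

/-- The average `x ↦ ∫ φ(y) u(y⁻¹ x) dν(y)` of the left translates of the bounded continuous
function `u` with weight `φ`. -/
noncomputable def translateAverage (ν : Measure G) [IsFiniteMeasureOnCompacts ν]
    (φ : C_c(G, ℝ)) (u : G →ᵇ ℝ) : G →ᵇ ℝ :=
  BoundedContinuousFunction.ofNormedAddCommGroup (fun x => ∫ y, φ y * u (y⁻¹ * x) ∂ν)
    (continuous_integral_mul_translate ν φ u) (∫ y, ‖φ y‖ * ‖u‖ ∂ν) fun x => by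
      refine norm_integral_le_of_norm_le ?_ (Eventually.of_forall fun y => ?_)
      · exact ((map_continuous φ).integrable_of_hasCompactSupport
          φ.hasCompactSupport).norm.mul_const _
      · rw [norm_mul]
        gcongr
        exact u.norm_coe_le_norm _

theorem translateAverage_apply (ν : Measure G) [IsFiniteMeasureOnCompacts ν]
    (φ : C_c(G, ℝ)) (u : G →ᵇ ℝ) (x : G) :
    translateAverage ν φ u x = ∫ y, φ y * u (y⁻¹ * x) ∂ν := rfl

variable [LocallyCompactSpace G] [T2Space G]

/-- For `u ≥ 0` the functional `φ ↦ m (∫ φ(y) u(y⁻¹ ·) dν(y))` on `C_c(G)` is positive and left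
invariant, hence a multiple of the Haar integral. -/
theorem mean_translateAverage_eq_of_nonneg (ν : Measure G) [ν.IsHaarMeasure]
    {m : (G →ᵇ ℝ) →ₗ[ℝ] ℝ} (hpos : ∀ f : G →ᵇ ℝ, (∀ x, 0 ≤ f x) → 0 ≤ m f)
    (hinv : ∀ (g : G) (f : G →ᵇ ℝ), m (f.compContinuous (ContinuousMap.mulLeft g)) = m f)
    {u : G →ᵇ ℝ} (hu : ∀ x, 0 ≤ u x) :
    ∃ c : ℝ, ∀ φ : C_c(G, ℝ), m (translateAverage ν φ u) = c * ∫ y, φ y ∂ν := by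
  let Λ₀ : C_c(G, ℝ) →ₗ[ℝ] ℝ :=
    { toFun := fun φ => m (translateAverage ν φ u)
      map_add' := fun φ ψ => by
        rw [← map_add]
        congr 1
        ext x
        simp only [BoundedContinuousFunction.coe_add, Pi.add_apply, translateAverage_apply,
          CompactlySupportedContinuousMap.coe_add, add_mul]
        exact integral_add (integrable_mul_translate ν φ u x) (integrable_mul_translate ν ψ u x)
      map_smul' := fun c φ => by
        rw [RingHom.id_apply, ← map_smul]
        congr 1
        ext x
        simp only [BoundedContinuousFunction.coe_smul, translateAverage_apply,
          CompactlySupportedContinuousMap.coe_smul, Pi.smul_apply, smul_eq_mul, mul_assoc]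
        exact integral_const_mul _ _ }
  let Λ : C_c(G, ℝ) →ₚ[ℝ] ℝ := PositiveLinearMap.mk₀ Λ₀ fun φ hφ =>
    hpos _ fun x => integral_nonneg fun y => mul_nonneg (hφ y) (hu _)
  have hΛ : ∀ φ, Λ φ = m (translateAverage ν φ u) := fun φ => rfl
  -- the Riesz representing measure of `Λ` inherits left invariance from `m`
  set τ := RealRMK.rieszMeasure Λ with hτ
  have hτinv : τ.IsMulLeftInvariant := by
    refine ⟨fun g => ?_⟩
    have hreg : (Measure.map (fun x => g * x) τ).Regular :=
      Measure.Regular.map (Homeomorph.mulLeft g)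
    refine Measure.ext_of_integral_eq_on_compactlySupported fun φ => ?_
    have hmap : ∫ x, φ x ∂(Measure.map (fun x => g * x) τ) = ∫ x, φ (g * x) ∂τ :=
      (Homeomorph.mulLeft g).toMeasurableEquiv.measurableEmbedding.integral_map _
    let φ' : C_c(G, ℝ) :=
      ⟨⟨fun x => φ (g * x), by have := φ.continuous; fun_prop⟩,
        φ.hasCompactSupport.comp_homeomorph (Homeomorph.mulLeft g)⟩
    have h1 : ∫ x, φ (g * x) ∂τ = Λ φ' := RealRMK.integral_rieszMeasure Λ φ'
    rw [hmap, h1, RealRMK.integral_rieszMeasure, hΛ, hΛ, ← hinv g (translateAverage ν φ u)]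
    congr 1
    ext x
    simp only [BoundedContinuousFunction.compContinuous_apply, ContinuousMap.coe_mulLeft,
      translateAverage_apply]
    rw [← integral_mul_left_eq_self (fun y => φ y * u (y⁻¹ * (g * x))) g]
    refine integral_congr_ae (Eventually.of_forall fun y => ?_)
    simp only [mul_inv_rev, mul_assoc, inv_mul_cancel_left]
    rfl
  refine ⟨(Measure.haarScalarFactor τ ν : ℝ), fun φ => ?_⟩
  have h2 := Measure.integral_isMulLeftInvariant_eq_smul_of_hasCompactSupport τ ν (map_continuous φ)
    φ.hasCompactSupport
  rw [RealRMK.integral_rieszMeasure, hΛ, integral_smul_nnreal_measure] at h2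
  exact h2

/-- A left-invariant mean is topologically left invariant: averaging a bounded continuous function
over its left translates, with a weight of integral zero, gives a function of mean zero. -/
theorem mean_translateAverage_eq_zero (ν : Measure G) [ν.IsHaarMeasure]
    {m : (G →ᵇ ℝ) →ₗ[ℝ] ℝ} (hpos : ∀ f : G →ᵇ ℝ, (∀ x, 0 ≤ f x) → 0 ≤ m f)
    (hinv : ∀ (g : G) (f : G →ᵇ ℝ), m (f.compContinuous (ContinuousMap.mulLeft g)) = m f)
    (u : G →ᵇ ℝ) {φ : C_c(G, ℝ)} (hφ : ∫ y, φ y ∂ν = 0) : m (translateAverage ν φ u) = 0 := by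
  -- a constant may be added to `u`, as it is averaged to zero
  obtain ⟨c, hc⟩ := mean_translateAverage_eq_of_nonneg ν hpos hinv
    (u := u + BoundedContinuousFunction.const G ‖u‖) fun x => by
      have := neg_le_of_abs_le (u.norm_coe_le_norm x)
      simp only [BoundedContinuousFunction.coe_add, Pi.add_apply,
        BoundedContinuousFunction.const_apply]
      linarith
  rw [← mul_zero c, ← hφ, ← hc]
  congr 1
  ext x
  rw [translateAverage_apply, translateAverage_apply]
  simp only [BoundedContinuousFunction.coe_add, Pi.add_apply,
    BoundedContinuousFunction.const_apply, mul_add]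
  rw [integral_add (integrable_mul_translate ν φ u x)
    (((map_continuous φ).integrable_of_hasCompactSupport φ.hasCompactSupport).mul_const _),
    integral_mul_const, hφ, zero_mul, add_zero]

end TopologicalInvariance

section Modular

/-- Right translation changes a left Haar integral by the factor by which it changes the measure. -/
theorem integral_comp_mul_right_eq_smul {G : Type*} [Group G] [TopologicalSpace G]
    [IsTopologicalGroup G] [MeasurableSpace G] [BorelSpace G] {ν : Measure G} {g : G} {c : ℝ≥0}
    (h : Measure.map (· * g) ν = c • ν) {H : Type*} [NormedAddCommGroup H] [NormedSpace ℝ H]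
    (F : G → H) : ∫ y, F (y * g) ∂ν = (c : ℝ) • ∫ y, F y ∂ν := by
  have h3 : ∫ y, F y ∂(Measure.map (· * g) ν) = ∫ y, F (y * g) ∂ν :=
    (Homeomorph.mulRight g).toMeasurableEquiv.measurableEmbedding.integral_map _
  rw [← h3, h, integral_smul_nnreal_measure]
  rfl

variable {G : Type*} [Group G] [TopologicalSpace G] [IsTopologicalGroup G] [LocallyCompactSpace G]
  [MeasurableSpace G] [BorelSpace G]

theorem continuous_integral_mul_right (ν : Measure G) [IsFiniteMeasureOnCompacts ν] {F : G → G → ℝ}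
    (hF : Continuous F.uncurry) {φ : G → ℝ} (hφ : HasCompactSupport φ)
    (hFφ : ∀ g y, φ (y * g) = 0 → F g y = 0) : Continuous fun g => ∫ y, F g y ∂ν := by
  rw [continuous_iff_continuousAt]
  intro g
  obtain ⟨s, hs, hsg⟩ := exists_compact_mem_nhds g
  refine ContinuousOn.continuousAt (s := s) ?_ hsg
  refine continuousOn_integral_of_compact_support (k := tsupport φ * s⁻¹)
    (IsCompact.mul hφ hs.inv) hF.continuousOn fun x y hx hy => hFφ x y ?_
  refine image_eq_zero_of_notMem_tsupport fun h => hy ?_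
  exact ⟨y * x, h, x⁻¹, Set.inv_mem_inv.2 hx, by simp⟩

theorem exists_compactlySupported_integral_eq_one (ν : Measure G) [ν.IsHaarMeasure] :
    ∃ φ : C_c(G, ℝ), (∀ x, 0 ≤ φ x) ∧ ∫ x, φ x ∂ν = 1 := by
  obtain ⟨⟨f, hf⟩, hfc, hf0, hf1⟩ :
    ∃ f : C(G, ℝ), HasCompactSupport f ∧ 0 ≤ f ∧ f 1 ≠ 0 := exists_continuous_nonneg_pos 1
  have hpos : 0 < ∫ x, f x ∂ν := hf.integral_pos_of_hasCompactSupport_nonneg_nonzero hfc hf0 hf1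
  refine ⟨(∫ x, f x ∂ν)⁻¹ • (⟨⟨f, hf⟩, hfc⟩ : C_c(G, ℝ)),
    fun x => mul_nonneg (inv_nonneg.2 hpos.le) (hf0 x), ?_⟩
  have : ∀ x, ((∫ x, f x ∂ν)⁻¹ • (⟨⟨f, hf⟩, hfc⟩ : C_c(G, ℝ))) x = (∫ x, f x ∂ν)⁻¹ * f x :=
    fun x => rfl
  simp only [this]
  rw [integral_const_mul, inv_mul_cancel₀ hpos.ne']

/-- The modular function of `G` is continuous: for `φ` of integral `1` its value at `g` is the
integral of `y ↦ φ (y g)`. -/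
theorem exists_continuous_map_mul_right_eq_smul (ν : Measure G) [ν.IsHaarMeasure] [ν.Regular] :
    ∃ Δ : G → ℝ≥0, Continuous Δ ∧ ∀ g, Measure.map (· * g) ν = Δ g • ν := by
  have hmap : ∀ g, Measure.map (· * g) ν =
      Measure.haarScalarFactor (Measure.map (· * g) ν) ν • ν := fun g => by
    have : (Measure.map (· * g) ν).Regular := Measure.Regular.map (Homeomorph.mulRight g)
    exact Measure.isMulLeftInvariant_eq_smul_of_regular _ _
  refine ⟨_, ?_, hmap⟩
  obtain ⟨φ, -, hφ⟩ := exists_compactlySupported_integral_eq_one ν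
  rw [NNReal.isEmbedding_coe.continuous_iff]
  have h2 : ∀ g, (Measure.haarScalarFactor (Measure.map (· * g) ν) ν : ℝ) =
      ∫ y, φ (y * g) ∂ν := fun g => by
    have h3 : ∫ y, φ y ∂(Measure.map (· * g) ν) = ∫ y, φ (y * g) ∂ν :=
      (Homeomorph.mulRight g).toMeasurableEquiv.measurableEmbedding.integral_map _
    rw [← h3]
    conv_rhs => rw [hmap g]
    rw [integral_smul_nnreal_measure, hφ, NNReal.smul_def, smul_eq_mul, mul_one]
  simp only [Function.comp_def, h2]
  refine continuous_integral_mul_right ν ?_ φ.hasCompactSupport fun g y h => h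
  have := φ.continuous
  simp only [Function.uncurry_def]
  fun_prop

end Modular

/-! ### Almost invariant functions in `L¹(G)` -/

section LeftTranslation

variable {G : Type*} [Group G] [TopologicalSpace G] [IsTopologicalGroup G]
  [MeasurableSpace G] [BorelSpace G]
  {E : Type*} [NormedAddCommGroup E] {p : ℝ≥0∞} [Fact (1 ≤ p)]

/-- Left translation `(L_y f)(x) = f (y⁻¹ x)` on `L^p(G; E)`. -/
noncomputable def leftTranslation (𝕜 : Type*) [NormedField 𝕜] [NormedSpace 𝕜 E] (ν : Measure G)
    [ν.IsMulLeftInvariant] (y : G) : Lp E p ν →L[𝕜] Lp E p ν :=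
  (Lp.compMeasurePreservingₗᵢ 𝕜 (y⁻¹ * ·)
    (measurePreserving_mul_left ν y⁻¹)).toContinuousLinearMap

variable {𝕜 : Type*} [NormedField 𝕜] [NormedSpace 𝕜 E] (ν : Measure G) [ν.IsMulLeftInvariant]

theorem leftTranslation_eq_smul (y : G) (f : Lp E p ν) :
    leftTranslation 𝕜 ν y f = DomMulAct.mk y⁻¹ • f := rfl

theorem leftTranslation_coeFn (y : G) (f : Lp E p ν) :
    leftTranslation 𝕜 ν y f =ᵐ[ν] fun x => f (y⁻¹ * x) :=
  Lp.coeFn_compMeasurePreserving f (measurePreserving_mul_left ν y⁻¹)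

theorem leftTranslation_toLp (y : G) {f : G → E} (hf : MemLp f p ν) :
    leftTranslation 𝕜 ν y (hf.toLp f) =
      (hf.comp_measurePreserving (measurePreserving_mul_left ν y⁻¹)).toLp (fun x => f (y⁻¹ * x)) :=
  rfl

theorem norm_leftTranslation (y : G) (f : Lp E p ν) : ‖leftTranslation 𝕜 ν y f‖ = ‖f‖ :=
  (Lp.compMeasurePreservingₗᵢ 𝕜 (y⁻¹ * ·) (measurePreserving_mul_left ν y⁻¹)).norm_map f

theorem leftTranslation_mul (y z : G) (f : Lp E p ν) :
    leftTranslation 𝕜 ν (y * z) f = leftTranslation 𝕜 ν y (leftTranslation 𝕜 ν z f) := by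
  simp only [leftTranslation_eq_smul, smul_smul, mul_inv_rev, ← DomMulAct.mk_mul]

theorem continuous_leftTranslation [LocallyCompactSpace G] [ν.Regular]
    (hp : p ≠ ∞) (f : Lp E p ν) : Continuous fun y => leftTranslation 𝕜 ν y f := by
  have : Fact (p ≠ ∞) := ⟨hp⟩
  have h : Continuous fun y : G => DomMulAct.mk y⁻¹ :=
    DomMulAct.continuous_mk.comp continuous_inv
  simp only [leftTranslation_eq_smul]
  exact h.smul continuous_const

end LeftTranslation

section Reiter

theorem integrable_compactlySupported {X : Type*} [TopologicalSpace X] [MeasurableSpace X]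
    [OpensMeasurableSpace X] (ν : Measure X) [IsFiniteMeasureOnCompacts ν] (φ : C_c(X, ℝ)) :
    Integrable φ ν :=
  (map_continuous φ).integrable_of_hasCompactSupport φ.hasCompactSupport

theorem integralCLM_leftTranslation {G : Type*} [Group G] [TopologicalSpace G]
    [IsTopologicalGroup G] [MeasurableSpace G] [BorelSpace G] (ν : Measure G)
    [ν.IsMulLeftInvariant] (y : G) (ψ : Lp ℝ 1 ν) :
    L1.integralCLM (leftTranslation ℝ ν y ψ) = L1.integralCLM ψ := by
  rw [← L1.integral_eq, ← L1.integral_eq, L1.integral_eq_integral, L1.integral_eq_integral,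
    integral_congr_ae (leftTranslation_coeFn ν y ψ)]
  exact integral_mul_left_eq_self _ _

variable {G : Type*} [Group G] [TopologicalSpace G] [IsTopologicalGroup G] [LocallyCompactSpace G]
  [MeasurableSpace G] [BorelSpace G] (ν : Measure G) [ν.IsHaarMeasure] [ν.Regular]

theorem integrable_smul_leftTranslation_inv (φ : C_c(G, ℝ)) (ψ : Lp ℝ 1 ν) :
    Integrable (fun y => φ y • leftTranslation ℝ ν y⁻¹ ψ) ν :=
  ((map_continuous φ).smul ((continuous_leftTranslation ν ENNReal.one_ne_top ψ).comp
    continuous_inv)).integrable_of_hasCompactSupport φ.hasCompactSupport.smul_right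

/-- The smoothing operator `ψ ↦ ∫ φ(y) L_{y⁻¹} ψ dν(y)` on `L¹(G)`. The inverse is there because
the functional `φ ↦ m (x ↦ Λ (∫ φ(y) L_{y⁻¹} (L_x η) dν(y)))` is then left invariant. -/
noncomputable def smoothing (φ : C_c(G, ℝ)) : Lp ℝ 1 ν →L[ℝ] Lp ℝ 1 ν :=
  LinearMap.mkContinuous
    { toFun := fun ψ => ∫ y, φ y • leftTranslation ℝ ν y⁻¹ ψ ∂ν
      map_add' := fun ψ χ => by
        simp only [map_add, smul_add]
        exact integral_add (integrable_smul_leftTranslation_inv ν φ ψ)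
          (integrable_smul_leftTranslation_inv ν φ χ)
      map_smul' := fun c ψ => by
        simp only [map_smul, RingHom.id_apply, smul_comm _ c]
        exact integral_smul c _ }
    (∫ y, ‖φ y‖ ∂ν) fun ψ => by
      rw [← integral_mul_const]
      refine norm_integral_le_of_norm_le ((integrable_compactlySupported ν φ).norm.mul_const _)
        (Eventually.of_forall fun y => ?_)
      rw [norm_smul, norm_leftTranslation]

theorem smoothing_apply (φ : C_c(G, ℝ)) (ψ : Lp ℝ 1 ν) :
    smoothing ν φ ψ = ∫ y, φ y • leftTranslation ℝ ν y⁻¹ ψ ∂ν := rfl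

theorem norm_smoothing_le (φ : C_c(G, ℝ)) (ψ : Lp ℝ 1 ν) :
    ‖smoothing ν φ ψ‖ ≤ (∫ y, ‖φ y‖ ∂ν) * ‖ψ‖ :=
  ContinuousLinearMap.le_of_opNorm_le _
    (LinearMap.mkContinuous_norm_le _ (integral_nonneg fun _ => norm_nonneg _) _) ψ

theorem smoothing_sub (φ χ : C_c(G, ℝ)) (ψ : Lp ℝ 1 ν) :
    smoothing ν (φ - χ) ψ = smoothing ν φ ψ - smoothing ν χ ψ := by
  rw [smoothing_apply, smoothing_apply, smoothing_apply,
    ← integral_sub (integrable_smul_leftTranslation_inv ν φ ψ)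
      (integrable_smul_leftTranslation_inv ν χ ψ)]
  simp only [CompactlySupportedContinuousMap.coe_sub, Pi.sub_apply, sub_smul]

theorem integralCLM_smoothing (φ : C_c(G, ℝ)) (ψ : Lp ℝ 1 ν) :
    L1.integralCLM (smoothing ν φ ψ) = (∫ y, φ y ∂ν) * L1.integralCLM ψ := by
  rw [smoothing_apply, ← ContinuousLinearMap.integral_comp_comm _
    (integrable_smul_leftTranslation_inv ν φ ψ)]
  simp only [map_smul, integralCLM_leftTranslation, smul_eq_mul]
  exact integral_mul_const _ _

/-- Day's convexity argument: if the vectors `S_{d_j} ψ` could not all be made small, a functional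
separating them from `0` would produce bounded continuous functions contradicting topological
invariance of the mean. -/
theorem exists_norm_smoothing_lt [T2Space G] (hG : IsAmenableGroup G) {J : Type*} [Fintype J]
    (d : J → C_c(G, ℝ)) (hd : ∀ j, ∫ y, d j y ∂ν = 0) {ε : ℝ} (hε : 0 < ε) :
    ∃ ψ : Lp ℝ 1 ν, ‖ψ‖ ≤ 1 ∧ L1.integralCLM ψ = 1 ∧ ∀ j, ‖smoothing ν (d j) ψ‖ < ε := by
  classical
  obtain ⟨m, hpos, hone, hinv⟩ := hG
  by_contra! hcon
  set Q : Set (Lp ℝ 1 ν) := {ψ | ‖ψ‖ ≤ 1 ∧ L1.integralCLM ψ = 1} with hQ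
  have hQc : Convex ℝ Q := by
    have h1 : Convex ℝ (Metric.closedBall (0 : Lp ℝ 1 ν) 1) := convex_closedBall 0 1
    have h2 : Convex ℝ {ψ : Lp ℝ 1 ν | L1.integralCLM ψ = (1 : ℝ)} :=
      convex_hyperplane (L1.integralCLM (α := G) (E := ℝ) (μ := ν)).toLinearMap.isLinear 1
    have h3 := h1.inter h2
    convert h3 using 1
    ext ψ
    simp [hQ]
  set D : Lp ℝ 1 ν →L[ℝ] (J → Lp ℝ 1 ν) := ContinuousLinearMap.pi fun j => smoothing ν (d j)
    with hD
  have hdisj : Disjoint (Metric.ball (0 : J → Lp ℝ 1 ν) ε) (D '' Q) := by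
    rw [Set.disjoint_right]
    rintro _ ⟨ψ, hψ, rfl⟩ hball
    obtain ⟨j, hj⟩ := hcon ψ hψ.1 hψ.2
    rw [mem_ball_zero_iff, pi_norm_lt_iff hε] at hball
    exact absurd (hball j) (not_lt.2 hj)
  -- `f` is at least `s > 0` on the image of all normalised `ψ`, among them the translates of `η`
  obtain ⟨f, s, hf1, hf2⟩ := geometric_hahn_banach_open (convex_ball 0 ε) Metric.isOpen_ball
    (hQc.linear_image D.toLinearMap) hdisj
  have hs : 0 < s := by simpa using hf1 0 (Metric.mem_ball_self hε)
  obtain ⟨φ, hφ0, hφ1⟩ := exists_compactlySupported_integral_eq_one ν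
  set η : Lp ℝ 1 ν := (integrable_compactlySupported ν φ).toL1 φ with hη
  have hη1 : ‖η‖ = 1 := by
    rw [hη, L1.norm_of_fun_eq_integral_norm, ← hφ1]
    exact integral_congr_ae (Eventually.of_forall fun x => Real.norm_of_nonneg (hφ0 x))
  have hηI : L1.integralCLM η = (1 : ℝ) := by
    rw [← L1.integral_eq, hη, ← hφ1]
    exact (integral_eq φ (integrable_compactlySupported ν φ)).symm
  let u : J → (G →ᵇ ℝ) := fun j => BoundedContinuousFunction.ofNormedAddCommGroup
    (fun x => f (Pi.single j (leftTranslation ℝ ν x η)))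
    (f.continuous.comp ((continuous_single j).comp
      (continuous_leftTranslation ν ENNReal.one_ne_top η))) (‖f‖ * 1) fun x => by
      refine (f.le_opNorm _).trans ?_
      gcongr
      rw [Pi.norm_single, norm_leftTranslation, hη1]
  have hsum : ∀ x, f (D (leftTranslation ℝ ν x η)) =
      ∑ j, translateAverage ν (d j) (u j) x := by
    intro x
    have h1 : D (leftTranslation ℝ ν x η) =
        ∑ j, Pi.single j (smoothing ν (d j) (leftTranslation ℝ ν x η)) :=
      (Finset.univ_sum_single _).symm
    rw [h1, map_sum]
    refine Finset.sum_congr rfl fun j _ => ?_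
    have h2 := ContinuousLinearMap.integral_comp_comm
      (f.comp (ContinuousLinearMap.single ℝ (fun _ : J => Lp ℝ 1 ν) j))
      (integrable_smul_leftTranslation_inv ν (d j) (leftTranslation ℝ ν x η))
    rw [← smoothing_apply] at h2
    refine h2.symm.trans ?_
    rw [translateAverage_apply]
    refine integral_congr_ae (Eventually.of_forall fun y => ?_)
    simp only [map_smul, smul_eq_mul, ← leftTranslation_mul]
    rfl
  have hge : ∀ x, s ≤ ∑ j, translateAverage ν (d j) (u j) x := fun x => by
    rw [← hsum]
    refine hf2 _ ⟨_, ⟨?_, ?_⟩, rfl⟩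
    · rw [norm_leftTranslation, hη1]
    · rw [integralCLM_leftTranslation, hηI]
  -- the mean of the right-hand side of `hge` is zero, but that of `s` is `s`
  have h1 := hpos (∑ j, translateAverage ν (d j) (u j) - s • BoundedContinuousFunction.const G 1)
    fun x => by
      have := hge x
      simp only [BoundedContinuousFunction.coe_sub, Pi.sub_apply,
        BoundedContinuousFunction.coe_sum, Finset.sum_apply, BoundedContinuousFunction.coe_smul,
        BoundedContinuousFunction.const_apply, smul_eq_mul, mul_one]
      linarith
  rw [map_sub, map_sum, map_smul, hone, Finset.sum_eq_zero fun j _ =>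
    mean_translateAverage_eq_zero ν hpos hinv (u j) (hd j), smul_eq_mul] at h1
  linarith

/-- Left translates of a smoothed function are again smoothed functions, with a weight that depends
continuously on the translation; so a smoothed function moves uniformly little once it moves
little under finitely many weights. -/
theorem exists_norm_leftTranslation_sub_le [T2Space G] (hG : IsAmenableGroup G) {K : Set G}
    (hK : IsCompact K) {ε : ℝ} (hε : 0 < ε) :
    ∃ ψ : Lp ℝ 1 ν, L1.integralCLM ψ = (1 : ℝ) ∧
      ∀ y ∈ K, ‖leftTranslation ℝ ν y ψ - ψ‖ ≤ ε := by
  obtain ⟨Δ, hΔc, hΔ⟩ := exists_continuous_map_mul_right_eq_smul ν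
  obtain ⟨φ, hφ0, hφ1⟩ := exists_compactlySupported_integral_eq_one ν
  have hφc : Continuous φ := map_continuous φ
  -- the weight of the smoothing by `φ` followed by translation by `g⁻¹`
  let w : G → C_c(G, ℝ) := fun g =>
    ⟨⟨fun y => Δ g * φ (y * g⁻¹), by fun_prop⟩,
      (φ.hasCompactSupport.comp_homeomorph (Homeomorph.mulRight g⁻¹)).mul_left⟩
  have hw : ∀ g y, w g y = Δ g * φ (y * g⁻¹) := fun g y => rfl
  have hint : ∀ g, ∫ y, w g y ∂ν = 1 := by
    intro g
    have := integral_comp_mul_right_eq_smul (hΔ g) fun y => φ (y * g⁻¹)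
    simp only [mul_inv_cancel_right, hφ1] at this
    simp only [hw]
    rw [integral_const_mul, this, smul_eq_mul]
  have htrans : ∀ g ψ, leftTranslation ℝ ν g⁻¹ (smoothing ν φ ψ) = smoothing ν (w g) ψ := by
    intro g ψ
    have := integral_comp_mul_right_eq_smul (hΔ g) fun y => φ (y * g⁻¹) • leftTranslation ℝ ν y⁻¹ ψ
    rw [smoothing_apply, smoothing_apply, ← ContinuousLinearMap.integral_comp_comm _
      (integrable_smul_leftTranslation_inv ν φ ψ)]
    simp only [hw, mul_smul, map_smul, ← leftTranslation_mul]
    rw [integral_smul, ← this]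
    simp only [mul_inv_cancel_right, mul_inv_rev]
  -- `w` is continuous for the `L¹` norm, so finitely many `w g` approximate all `w y⁻¹`, `y ∈ K`
  have hnhds : ∀ g ∈ K⁻¹, {g' | ∫ y, ‖(w g' - w g) y‖ ∂ν < ε / 2} ∈ 𝓝 g := by
    intro g _
    obtain ⟨s, hs, hsg⟩ := exists_compact_mem_nhds g
    have hcont : ContinuousAt (fun g' => ∫ y, ‖(w g' - w g) y‖ ∂ν) g := by
      refine ContinuousOn.continuousAt (s := s) ?_ hsg
      refine continuousOn_integral_of_compact_support (k := tsupport φ * s)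
        (IsCompact.mul φ.hasCompactSupport hs) (Continuous.continuousOn ?_) fun x y hx hy => ?_
      · simp only [Function.uncurry_def, CompactlySupportedContinuousMap.coe_sub, Pi.sub_apply, hw]
        fun_prop
      · have h0 : ∀ z ∈ s, φ (y * z⁻¹) = 0 := fun z hz =>
          image_eq_zero_of_notMem_tsupport fun h => hy ⟨_, h, z, hz, by simp⟩
        simp only [CompactlySupportedContinuousMap.coe_sub, Pi.sub_apply, hw, h0 x hx,
          h0 g (mem_of_mem_nhds hsg), mul_zero, sub_zero, norm_zero]
    refine hcont.eventually_lt continuousAt_const ?_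
    simpa using hε
  obtain ⟨t, -, ht⟩ := hK.inv.elim_nhds_subcover _ hnhds
  obtain ⟨ψ, hψ1, hψI, hψ⟩ := exists_norm_smoothing_lt ν hG (J := t)
    (fun j => w j - φ) (fun j => by
      simp only [CompactlySupportedContinuousMap.coe_sub, Pi.sub_apply]
      rw [integral_sub (integrable_compactlySupported ν _) (integrable_compactlySupported ν _),
        hint, hφ1, sub_self]) (half_pos hε)
  refine ⟨smoothing ν φ ψ, by rw [integralCLM_smoothing, hφ1, hψI, one_mul], fun y hy => ?_⟩
  obtain ⟨g, hg, hyg⟩ := Set.mem_iUnion₂.1 (ht (Set.inv_mem_inv.2 hy))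
  have h1 := htrans y⁻¹ ψ
  rw [inv_inv] at h1
  have h2 := hψ ⟨g, hg⟩
  rw [smoothing_sub] at h2
  have h3 := norm_smoothing_le ν (w y⁻¹ - w g) ψ
  rw [smoothing_sub] at h3
  have h4 : (∫ z, ‖(w y⁻¹ - w g) z‖ ∂ν) * ‖ψ‖ ≤ ε / 2 * 1 := by
    gcongr
    exact le_of_lt hyg
  rw [h1]
  calc _ = ‖(smoothing ν (w y⁻¹) ψ - smoothing ν (w g) ψ) +
        (smoothing ν (w g) ψ - smoothing ν φ ψ)‖ := by rw [sub_add_sub_cancel]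
    _ ≤ _ := norm_add_le _ _
    _ ≤ ε := by linarith

end Reiter

/-! ### Almost invariant functions in `L^p(G)` -/

section Density

variable {X : Type*} [TopologicalSpace X] [LocallyCompactSpace X] [T2Space X] [MeasurableSpace X]
  [BorelSpace X] {E : Type*} [NormedAddCommGroup E] [NormedSpace ℝ E] {ν : Measure X} [ν.Regular]
  {p : ℝ≥0∞}

/-- Continuous functions with compact support are dense in `L^p` of a regular measure on a locally
compact Hausdorff space, which need not be normal. -/
theorem MeasureTheory.MemLp.exists_continuous_hasCompactSupport_eLpNorm_sub_le (hp : p ≠ ∞)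
    {f : X → E} (hf : MemLp f p ν) {ε : ℝ≥0∞} (hε : ε ≠ 0) :
    ∃ g : X → E, eLpNorm (f - g) p ν ≤ ε ∧ Continuous g ∧ HasCompactSupport g := by
  apply hf.induction_dense hp _ _ _ _ hε
  rotate_left
  · exact fun f g hf hg => ⟨hf.1.add hg.1, hf.2.add hg.2⟩
  · exact fun g hg => (hg.1.memLp_of_hasCompactSupport (p := p) hg.2).aestronglyMeasurable
  -- a compact `s` inside `t` and an open `V` around `s`, both within little measure of `s`
  intro c t ht htν ε hε
  obtain ⟨η, hη0, hη⟩ : ∃ η : ℝ≥0, 0 < η ∧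
      ∀ s : Set X, ν s ≤ η → eLpNorm (s.indicator fun _ => c) p ν ≤ ε :=
    exists_eLpNorm_indicator_le hp c hε
  have hη2 : (η : ℝ≥0∞) / 2 ≠ 0 := by simpa using hη0.ne'
  obtain ⟨s, hst, hs, hsη⟩ := ht.exists_isCompact_sdiff_lt htν.ne hη2
  obtain ⟨V, hsV, hV, -, hVη⟩ := hs.measurableSet.exists_isOpen_sdiff_lt
    ((measure_mono hst).trans_lt htν).ne hη2
  obtain ⟨f, hf1, hf0, hfc, hf01⟩ := exists_continuous_one_zero_of_isCompact hs hV.isClosed_compl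
    (Set.disjoint_compl_right_iff_subset.2 hsV)
  refine ⟨fun x => f x • c, ?_, by fun_prop, hfc.smul_right⟩
  refine le_trans (eLpNorm_mono fun x => ?_) (hη (V \ s ∪ t \ s) ?_)
  · by_cases hxs : x ∈ s
    · simp [hf1 hxs, hst hxs]
    have hn : ‖f x • c‖ ≤ ‖c‖ := by
      rw [norm_smul, Real.norm_of_nonneg (hf01 x).1]
      exact mul_le_of_le_one_left (norm_nonneg _) (hf01 x).2
    by_cases hxt : x ∈ t
    · have h1 : f x • c - c = -((1 - f x) • c) := by rw [sub_smul, one_smul, neg_sub]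
      rw [Set.indicator_of_mem (show x ∈ V \ s ∪ t \ s from Or.inr ⟨hxt, hxs⟩), Pi.sub_apply,
        Set.indicator_of_mem hxt, h1, norm_neg, norm_smul,
        Real.norm_of_nonneg (sub_nonneg.2 (hf01 x).2)]
      exact mul_le_of_le_one_left (norm_nonneg _) (by linarith [(hf01 x).1])
    by_cases hxV : x ∈ V
    · rw [Set.indicator_of_mem (show x ∈ V \ s ∪ t \ s from Or.inl ⟨hxV, hxs⟩), Pi.sub_apply,
        Set.indicator_of_notMem hxt, sub_zero]
      exact hn
    · simp [hf0 hxV, hxt]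
  · refine (measure_union_le _ _).trans ?_
    rw [← ENNReal.add_halves (η : ℝ≥0∞)]
    exact add_le_add hVη.le hsη.le

end Density

theorem abs_rpow_sub_rpow_le {q s t : ℝ} (hs : 0 ≤ s) (ht : 0 ≤ t) (hq0 : 0 ≤ q) (hq1 : q ≤ 1) :
    |s ^ q - t ^ q| ≤ |s - t| ^ q := by
  wlog h : t ≤ s generalizing s t
  · rw [abs_sub_comm, abs_sub_comm s]
    exact this ht hs (le_of_not_ge h)
  rw [abs_of_nonneg (sub_nonneg.2 (Real.rpow_le_rpow ht h hq0)), abs_of_nonneg (sub_nonneg.2 h)]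
  have := Real.rpow_add_le_add_rpow ht (sub_nonneg.2 h) hq0 hq1
  rw [add_sub_cancel] at this
  linarith

section AlmostInvariant

variable {G : Type*} [Group G] [TopologicalSpace G] [IsTopologicalGroup G] [LocallyCompactSpace G]
  [T2Space G] [MeasurableSpace G] [BorelSpace G] (ν : Measure G) [ν.IsHaarMeasure] [ν.Regular]

/-- Reiter's property: an amenable group carries continuous functions of compact support with
nonzero integral that are almost invariant, in the `L¹` norm, under a given compact set. -/
theorem exists_compactlySupported_lintegral_sub_le (hG : IsAmenableGroup G) {K : Set G}
    (hK : IsCompact K) {ε : ℝ} (hε : 0 < ε) :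
    ∃ F : C_c(G, ℝ), 2⁻¹ ≤ ∫⁻ x, ‖F x‖ₑ ∂ν ∧
      ∀ y ∈ K, ∫⁻ x, ‖F (y⁻¹ * x) - F x‖ₑ ∂ν ≤ ENNReal.ofReal ε := by
  obtain ⟨ψ, hψI, hψ⟩ := exists_norm_leftTranslation_sub_le ν hG hK (ε := ε / 3) (by positivity)
  -- within `1 / 2` of `ψ`, the integral of `F` stays at least `1 / 2` in modulus
  set δ := min (ε / 3) (1 / 2) with hδ
  have hδ0 : 0 < δ := lt_min (by positivity) (by norm_num)
  obtain ⟨F, hF, hFc, hFs⟩ := (Lp.memLp ψ).exists_continuous_hasCompactSupport_eLpNorm_sub_le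
    ENNReal.one_ne_top (ε := ENNReal.ofReal δ) (by simpa using hδ0)
  have hFm : MemLp F 1 ν := hFc.memLp_of_hasCompactSupport hFs
  set f : Lp ℝ 1 ν := hFm.toLp F with hf
  have hfψ : ‖f - ψ‖ ≤ δ := by
    rw [← Lp.toLp_coeFn ψ (Lp.memLp ψ), hf, ← norm_neg, neg_sub, ← MemLp.toLp_sub, Lp.norm_toLp]
    exact ENNReal.toReal_le_of_le_ofReal hδ0.le hF
  refine ⟨⟨⟨F, hFc⟩, hFs⟩, ?_, fun y hy => ?_⟩
  · change 2⁻¹ ≤ ∫⁻ x, ‖F x‖ₑ ∂ν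
    have h1 : ‖(L1.integralCLM (f - ψ) : ℝ)‖ ≤ δ := by
      rw [← L1.integral_eq]
      exact (L1.norm_integral_le (f - ψ)).trans hfψ
    have h2 : ‖(L1.integralCLM f : ℝ)‖ ≤ ‖f‖ := by
      rw [← L1.integral_eq]
      exact L1.norm_integral_le f
    rw [map_sub, hψI] at h1
    have h3 : (1 / 2 : ℝ) ≤ ‖f‖ := by
      have h4 := norm_sub_rev (L1.integralCLM f : ℝ) 1
      have h5 := norm_sub_norm_le (1 : ℝ) (L1.integralCLM f)
      have h6 : δ ≤ 1 / 2 := min_le_right _ _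
      rw [norm_one] at h5
      linarith
    rw [← eLpNorm_one_eq_lintegral_enorm, ← Lp.enorm_toLp hFm, ← hf, ← ofReal_norm]
    refine le_trans (le_of_eq ?_) (ENNReal.ofReal_le_ofReal h3)
    rw [one_div, ENNReal.ofReal_inv_of_pos two_pos, ENNReal.ofReal_ofNat]
  · change ∫⁻ x, ‖F (y⁻¹ * x) - F x‖ₑ ∂ν ≤ ENNReal.ofReal ε
    have h1 : leftTranslation ℝ ν y f - f = leftTranslation ℝ ν y (f - ψ) +
        (leftTranslation ℝ ν y ψ - ψ) - (f - ψ) := by rw [map_sub]; abel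
    have h2 : ‖leftTranslation ℝ ν y f - f‖ ≤ ε := by
      rw [h1]
      refine (norm_sub_le _ _).trans ?_
      have h3 := norm_add_le (leftTranslation ℝ ν y (f - ψ)) (leftTranslation ℝ ν y ψ - ψ)
      rw [norm_leftTranslation] at h3
      have := hψ y hy
      have := min_le_left (ε / 3) (1 / 2)
      linarith
    rw [hf, leftTranslation_toLp, ← MemLp.toLp_sub] at h2
    have h3 := ENNReal.ofReal_le_ofReal h2
    rwa [ofReal_norm, Lp.enorm_toLp, eLpNorm_one_eq_lintegral_enorm] at h3

/-- The `p`-th root of an `L¹` almost invariant function is almost invariant in `L^p`, because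
`|s ^ (1/p) - t ^ (1/p)| ^ p ≤ |s - t|`. -/
theorem exists_almostInvariant (hG : IsAmenableGroup G) {p : ℝ≥0∞} [Fact (1 ≤ p)] (hp : p ≠ ∞)
    {K : Set G} (hK : IsCompact K) {ε : ℝ} (hε : 0 < ε) :
    ∃ g : C_c(G, ℝ), (∀ x, 0 ≤ g x) ∧ eLpNorm g p ν = 1 ∧
      ∀ y ∈ K, eLpNorm (fun x => g (y⁻¹ * x) - g x) p ν ≤ ENNReal.ofReal ε := by
  have hp1 : 1 ≤ p := Fact.out
  have hp0 : p ≠ 0 := (zero_lt_one.trans_le hp1).ne'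
  set q := p.toReal with hq
  have hq1 : 1 ≤ q := by
    rw [hq, ← ENNReal.toReal_one]
    exact ENNReal.toReal_mono hp hp1
  have hq0 : 0 < q := zero_lt_one.trans_le hq1
  obtain ⟨F, hF, hFK⟩ := exists_compactlySupported_lintegral_sub_le ν hG hK
    (ε := ε ^ q / 2) (by positivity)
  have hFc : Continuous F := map_continuous F
  have hFi : Integrable F ν := integrable_compactlySupported ν F
  set a : ℝ := ∫ x, ‖F x‖ ∂ν with ha
  have haF : ENNReal.ofReal a = ∫⁻ x, ‖F x‖ₑ ∂ν := by
    rw [ha, ofReal_integral_norm_eq_lintegral_enorm hFi]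
  have ha2 : 1 / 2 ≤ a := by
    rw [← haF] at hF
    rw [← ENNReal.ofReal_le_ofReal_iff (integral_nonneg fun x => norm_nonneg _)]
    refine le_trans (le_of_eq ?_) hF
    rw [one_div, ENNReal.ofReal_inv_of_pos two_pos, ENNReal.ofReal_ofNat]
  have ha0 : 0 < a := by linarith
  let g : C_c(G, ℝ) := ⟨⟨fun x => (|F x| / a) ^ (1 / q), by
      refine Continuous.rpow_const (by fun_prop) fun x => Or.inr (by positivity)⟩,
    F.hasCompactSupport.comp_left (g := fun t => (|t| / a) ^ (1 / q)) (by
      simp [hq0.ne'])⟩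
  have hg : ∀ x, g x = (|F x| / a) ^ (1 / q) := fun x => rfl
  have hdiv : ∀ t : ℝ, ENNReal.ofReal (|t| / a) = ‖t‖ₑ * (ENNReal.ofReal a)⁻¹ := fun t => by
    rw [ENNReal.ofReal_div_of_pos ha0, Real.enorm_eq_ofReal_abs, div_eq_mul_inv]
  refine ⟨g, fun x => by rw [hg]; positivity, ?_, fun y hy => ?_⟩
  · rw [eLpNorm_eq_lintegral_rpow_enorm_toReal hp0 hp]
    have h1 : ∀ x, ‖g x‖ₑ ^ p.toReal = ‖F x‖ₑ * (ENNReal.ofReal a)⁻¹ := fun x => by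
      rw [hg, Real.enorm_of_nonneg (by positivity), ENNReal.ofReal_rpow_of_nonneg (by positivity)
        hq0.le, ← Real.rpow_mul (by positivity), one_div_mul_cancel hq0.ne', Real.rpow_one, hdiv]
    simp only [h1]
    rw [lintegral_mul_const _ (by fun_prop), ← haF, ENNReal.mul_inv_cancel (by simpa using ha0)
      ENNReal.ofReal_ne_top, ENNReal.one_rpow]
  · rw [eLpNorm_eq_lintegral_rpow_enorm_toReal hp0 hp]
    have h1 : ∀ x, ‖g (y⁻¹ * x) - g x‖ₑ ^ p.toReal ≤
        ‖F (y⁻¹ * x) - F x‖ₑ * (ENNReal.ofReal a)⁻¹ := fun x => by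
      rw [← hdiv, Real.enorm_eq_ofReal_abs, ENNReal.ofReal_rpow_of_nonneg (by positivity) hq0.le]
      refine ENNReal.ofReal_le_ofReal ?_
      rw [hg, hg]
      calc _ ≤ (|(|F (y⁻¹ * x)| / a - |F x| / a)| ^ (1 / q)) ^ p.toReal := by
            refine Real.rpow_le_rpow (abs_nonneg _) ?_ hq0.le
            exact abs_rpow_sub_rpow_le (by positivity) (by positivity) (by positivity)
              ((div_le_one hq0).2 hq1)
        _ = |(|F (y⁻¹ * x)| / a - |F x| / a)| := by
            rw [← Real.rpow_mul (abs_nonneg _), one_div_mul_cancel hq0.ne', Real.rpow_one]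
        _ ≤ |F (y⁻¹ * x) - F x| / a := by
            rw [← sub_div, abs_div, abs_of_pos ha0]
            exact div_le_div_of_nonneg_right (abs_abs_sub_abs_le _ _) ha0.le
    calc _ ≤ (∫⁻ x, ‖F (y⁻¹ * x) - F x‖ₑ * (ENNReal.ofReal a)⁻¹ ∂ν) ^ (1 / p.toReal) := by
          gcongr with x
          exact h1 x
      _ ≤ (ENNReal.ofReal (ε ^ q)) ^ (1 / p.toReal) := by
          gcongr
          rw [lintegral_mul_const _ (by fun_prop)]
          calc _ ≤ ENNReal.ofReal (ε ^ q / 2) * (ENNReal.ofReal (1 / 2))⁻¹ := by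
                gcongr
                exact hFK y hy
            _ = ENNReal.ofReal (ε ^ q) := by
                rw [← ENNReal.ofReal_inv_of_pos (by norm_num), ← ENNReal.ofReal_mul (by positivity)]
                congr 1
                ring
      _ = ENNReal.ofReal ε := by
          rw [ENNReal.ofReal_rpow_of_nonneg (by positivity) (by positivity),
            ← Real.rpow_mul hε.le, mul_one_div_cancel hq0.ne', Real.rpow_one]

/-- The weight in the transference argument: finitely many integrable kernels cannot tell the
almost invariant function from an invariant one. -/
theorem exists_integral_norm_mul_norm_leftTranslation_sub_le (hG : IsAmenableGroup G)
    {p : ℝ≥0∞} [Fact (1 ≤ p)] (hp : p ≠ ∞) {𝕜 : Type*} [RCLike 𝕜] {N : ℕ} (k : Fin N → G → 𝕜)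
    (hk : ∀ i, Integrable (k i) ν) {ε : ℝ} (hε : 0 < ε) :
    ∃ (g : C_c(G, ℝ)) (hg : MemLp g p ν), ‖hg.toLp g‖ = 1 ∧
      ∀ i, ∫ y, ‖k i y‖ * ‖leftTranslation ℝ ν y (hg.toLp g) - hg.toLp g‖ ∂ν ≤ ε := by
  -- kernels of compact support first; on their supports the translates are uniformly close
  have hκ : ∀ i, ∃ κ : G → 𝕜, ∫ y, ‖k i y - κ y‖ ∂ν ≤ ε / 4 ∧ Continuous κ ∧
      HasCompactSupport κ := by
    intro i
    obtain ⟨κ, h1, h2, h3⟩ := (memLp_one_iff_integrable.2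
      (hk i)).exists_continuous_hasCompactSupport_eLpNorm_sub_le ENNReal.one_ne_top
      (ε := ENNReal.ofReal (ε / 4)) (by simpa using hε)
    refine ⟨κ, ?_, h2, h3⟩
    have h4 : AEStronglyMeasurable (fun y => k i y - κ y) ν :=
      ((hk i).sub (h2.integrable_of_hasCompactSupport h3)).aestronglyMeasurable
    rw [integral_norm_eq_lintegral_enorm h4]
    refine ENNReal.toReal_le_of_le_ofReal (by positivity) ?_
    rwa [eLpNorm_one_eq_lintegral_enorm] at h1
  choose κ hκ1 hκc hκs using hκ
  have hκi : ∀ i, Integrable (κ i) ν := fun i => (hκc i).integrable_of_hasCompactSupport (hκs i)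
  set I : ℝ := ∑ i, ∫ y, ‖κ i y‖ ∂ν with hI
  have hI0 : 0 ≤ I := Finset.sum_nonneg fun i _ => integral_nonneg fun y => norm_nonneg _
  obtain ⟨g, -, hg1, hgK⟩ := exists_almostInvariant ν hG hp
    (isCompact_iUnion fun i => hκs i) (ε := ε / (2 * (I + 1))) (by positivity)
  have hgm : MemLp g p ν := (map_continuous g).memLp_of_hasCompactSupport g.hasCompactSupport
  set γ : Lp ℝ p ν := hgm.toLp g with hγ
  have hγ1 : ‖γ‖ = 1 := by rw [hγ, Lp.norm_toLp, hg1, ENNReal.toReal_one]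
  refine ⟨g, hgm, hγ1, fun i => ?_⟩
  have hρc : Continuous fun y => ‖leftTranslation ℝ ν y γ - γ‖ :=
    ((continuous_leftTranslation ν hp γ).sub continuous_const).norm
  have hρ2 : ∀ y, ‖leftTranslation ℝ ν y γ - γ‖ ≤ 2 := fun y => by
    refine (norm_sub_le _ _).trans ?_
    rw [norm_leftTranslation, hγ1]
    norm_num
  have hρK : ∀ y, κ i y ≠ 0 → ‖leftTranslation ℝ ν y γ - γ‖ ≤ ε / (2 * (I + 1)) := fun y hy => by
    have h1 := hgK y (Set.mem_iUnion.2 ⟨i, subset_tsupport _ hy⟩)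
    rw [hγ, leftTranslation_toLp, ← MemLp.toLp_sub, Lp.norm_toLp]
    exact ENNReal.toReal_le_of_le_ofReal (by positivity) h1
  calc _ ≤ ∫ y, (‖k i y - κ i y‖ * 2 + ‖κ i y‖ * (ε / (2 * (I + 1)))) ∂ν := by
        refine integral_mono_of_nonneg (Eventually.of_forall fun y => by positivity)
          ((((hk i).sub (hκi i)).norm.mul_const _).add ((hκi i).norm.mul_const _))
          (Eventually.of_forall fun y => ?_)
        change ‖k i y‖ * ‖leftTranslation ℝ ν y γ - γ‖ ≤ _
        have h1 : ‖k i y‖ ≤ ‖k i y - κ i y‖ + ‖κ i y‖ := by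
          simpa using norm_add_le (k i y - κ i y) (κ i y)
        refine (mul_le_mul_of_nonneg_right h1 (norm_nonneg _)).trans ?_
        rw [add_mul]
        refine add_le_add (mul_le_mul_of_nonneg_left (hρ2 y) (norm_nonneg _)) ?_
        by_cases hy : κ i y = 0
        · simp [hy]
        · exact mul_le_mul_of_nonneg_left (hρK y hy) (norm_nonneg _)
    _ = (∫ y, ‖k i y - κ i y‖ ∂ν) * 2 + (∫ y, ‖κ i y‖ ∂ν) * (ε / (2 * (I + 1))) := by
        have h1 : Integrable (fun y => ‖k i y - κ i y‖ * 2) ν :=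
          ((hk i).sub (hκi i)).norm.mul_const _
        rw [integral_add h1 ((hκi i).norm.mul_const _), integral_mul_const, integral_mul_const]
    _ ≤ ε / 4 * 2 + (I + 1) * (ε / (2 * (I + 1))) := by
        gcongr
        · exact hκ1 i
        · exact (Finset.single_le_sum (f := fun i => ∫ y, ‖κ i y‖ ∂ν)
            (fun i _ => integral_nonneg fun y => norm_nonneg _) (Finset.mem_univ i)).trans
            (by linarith)
    _ = ε := by
        field_simp
        ring

end AlmostInvariant

/-! ### Convolution operators on `L^p(G; E)` -/

section Approximation

variable {X : Type*} [TopologicalSpace X] [LocallyCompactSpace X] [T2Space X] [MeasurableSpace X]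
  [BorelSpace X] {ν : Measure X} [ν.Regular] {𝕜 : Type*} [RCLike 𝕜]

theorem exists_seq_continuous_hasCompactSupport_tendsto {k : X → 𝕜} (hk : Integrable k ν) :
    ∃ κ : ℕ → X → 𝕜, (∀ n, Continuous (κ n)) ∧ (∀ n, HasCompactSupport (κ n)) ∧
      Tendsto (fun n => ∫ y, ‖k y - κ n y‖ ∂ν) atTop (𝓝 0) ∧
      ∀ᵐ y ∂ν, Tendsto (fun n => κ n y) atTop (𝓝 (k y)) := by
  have h0 : ∀ n : ℕ, ∃ κ : X → 𝕜, eLpNorm (k - κ) 1 ν ≤ (n : ℝ≥0∞)⁻¹ ∧ Continuous κ ∧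
      HasCompactSupport κ := fun n =>
    (memLp_one_iff_integrable.2 hk).exists_continuous_hasCompactSupport_eLpNorm_sub_le
      ENNReal.one_ne_top (ENNReal.inv_ne_zero.2 (ENNReal.natCast_ne_top n))
  choose κ hκ hκc hκs using h0
  have hκi : ∀ n, Integrable (κ n) ν := fun n => (hκc n).integrable_of_hasCompactSupport (hκs n)
  have hlim : Tendsto (fun n => eLpNorm (κ n - k) 1 ν) atTop (𝓝 0) := by
    refine tendsto_of_tendsto_of_tendsto_of_le_of_le tendsto_const_nhds
      ENNReal.tendsto_inv_nat_nhds_zero (fun n => zero_le) fun n => ?_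
    rw [eLpNorm_sub_comm]
    exact hκ n
  obtain ⟨ns, hns, hae⟩ := (tendstoInMeasure_of_tendsto_eLpNorm one_ne_zero
    (fun n => (hκi n).aestronglyMeasurable) hk.aestronglyMeasurable hlim).exists_seq_tendsto_ae
  refine ⟨fun n => κ (ns n), fun n => hκc _, fun n => hκs _, ?_, hae⟩
  have h1 : ∀ n, ∫ y, ‖k y - κ (ns n) y‖ ∂ν = (eLpNorm (κ (ns n) - k) 1 ν).toReal := fun n => by
    have h4 : AEStronglyMeasurable (fun y => k y - κ (ns n) y) ν :=
      (hk.sub (hκi (ns n))).aestronglyMeasurable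
    rw [integral_norm_eq_lintegral_enorm h4, eLpNorm_sub_comm, eLpNorm_one_eq_lintegral_enorm]
    rfl
  simp only [h1]
  simpa [Function.comp_def] using
    (ENNReal.tendsto_toReal ENNReal.zero_ne_top).comp (hlim.comp hns.tendsto_atTop)

/-- A continuous `v` need not be strongly measurable when neither `X` nor `Z` is second countable;
but `k • v` is, being a limit of continuous functions of compact support. -/
theorem MeasureTheory.Integrable.smul_continuous_of_bounded {Z : Type*} [NormedAddCommGroup Z]
    [NormedSpace 𝕜 Z] {k : X → 𝕜} (hk : Integrable k ν) {v : X → Z} (hv : Continuous v) {C : ℝ}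
    (hC : ∀ y, ‖v y‖ ≤ C) : Integrable (fun y => k y • v y) ν := by
  obtain ⟨κ, hκc, hκs, -, hκ⟩ := exists_seq_continuous_hasCompactSupport_tendsto hk
  have hm : AEStronglyMeasurable (fun y => k y • v y) ν := by
    refine aestronglyMeasurable_of_tendsto_ae atTop (f := fun n y => κ n y • v y) (fun n => ?_)
      (hκ.mono fun y hy => hy.smul_const _)
    exact (((hκc n).smul hv).memLp_of_hasCompactSupport (p := 1)
      (hκs n).smul_right).aestronglyMeasurable
  refine (hk.norm.mul_const C).mono' hm (Eventually.of_forall fun y => ?_)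
  rw [norm_smul]
  exact mul_le_mul_of_nonneg_left (hC y) (norm_nonneg _)

end Approximation

section ConvolutionOperator

variable {G : Type*} [Group G] [TopologicalSpace G] [IsTopologicalGroup G] [LocallyCompactSpace G]
  [T2Space G] [MeasurableSpace G] [BorelSpace G] {ν : Measure G} [ν.IsHaarMeasure] [ν.Regular]
  {𝕜 : Type*} [RCLike 𝕜] {E : Type*} [NormedAddCommGroup E] [NormedSpace 𝕜 E]
  {p : ℝ≥0∞} [Fact (1 ≤ p)]

theorem integrable_smul_leftTranslation (hp : p ≠ ∞) {k : G → 𝕜} (hk : Integrable k ν)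
    (F : Lp E p ν) : Integrable (fun y => k y • leftTranslation 𝕜 ν y F) ν :=
  hk.smul_continuous_of_bounded (continuous_leftTranslation ν hp F) fun y =>
    (norm_leftTranslation ν y F).le

variable [NormedSpace ℝ E]

/-- Convolution by `k ∈ L¹(G)` on `L^p(G; E)`, as the Bochner integral `∫ k(y) L_y F dν(y)`. -/
noncomputable def convOp (hp : p ≠ ∞) {k : G → 𝕜} (hk : Integrable k ν) :
    Lp E p ν →L[𝕜] Lp E p ν :=
  LinearMap.mkContinuous
    { toFun := fun F => ∫ y, k y • leftTranslation 𝕜 ν y F ∂ν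
      map_add' := fun F H => by
        simp only [map_add, smul_add]
        exact integral_add (integrable_smul_leftTranslation hp hk F)
          (integrable_smul_leftTranslation hp hk H)
      map_smul' := fun c F => by
        simp only [map_smul, RingHom.id_apply, smul_comm _ c]
        exact integral_smul c _ }
    (∫ y, ‖k y‖ ∂ν) fun F => by
      rw [← integral_mul_const]
      refine norm_integral_le_of_norm_le (hk.norm.mul_const _) (Eventually.of_forall fun y => ?_)
      rw [norm_smul, norm_leftTranslation]

theorem convOp_apply (hp : p ≠ ∞) {k : G → 𝕜} (hk : Integrable k ν) (F : Lp E p ν) :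
    convOp hp hk F = ∫ y, k y • leftTranslation 𝕜 ν y F ∂ν := rfl

theorem norm_convOp_le (hp : p ≠ ∞) {k : G → 𝕜} (hk : Integrable k ν) (F : Lp E p ν) :
    ‖convOp hp hk F‖ ≤ (∫ y, ‖k y‖ ∂ν) * ‖F‖ :=
  ContinuousLinearMap.le_of_opNorm_le _
    (LinearMap.mkContinuous_norm_le _ (integral_nonneg fun _ => norm_nonneg _) _) F

theorem convOp_sub (hp : p ≠ ∞) {k l : G → 𝕜} (hk : Integrable k ν) (hl : Integrable l ν)
    (F : Lp E p ν) : convOp hp (hk.sub hl) F = convOp hp hk F - convOp hp hl F := by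
  rw [convOp_apply, convOp_apply, convOp_apply,
    ← integral_sub (integrable_smul_leftTranslation hp hk F)
      (integrable_smul_leftTranslation hp hl F)]
  simp only [Pi.sub_apply, sub_smul]

end ConvolutionOperator

section Pointwise

section

variable {α 𝕜 : Type*} [RCLike 𝕜] [MeasurableSpace α] {ν : Measure α} {p : ℝ≥0∞} [Fact (1 ≤ p)]

/-- Integration over a set of finite measure, as a bounded functional on `L^p`. -/
noncomputable def setIntegralLp {s : Set α} (hs : ν s ≠ ∞) : Lp 𝕜 p ν →L[𝕜] 𝕜 :=
  have hi : ∀ f : Lp 𝕜 p ν, IntegrableOn f s ν := fun f =>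
    integrableOn_Lp_of_measure_ne_top f Fact.out hs
  LinearMap.mkContinuous
    { toFun := fun f => ∫ x in s, f x ∂ν
      map_add' := fun f g => by
        rw [← integral_add (hi f) (hi g)]
        exact integral_congr_ae (ae_restrict_of_ae (Lp.coeFn_add f g))
      map_smul' := fun c f => by
        rw [RingHom.id_apply, ← integral_smul]
        exact integral_congr_ae (ae_restrict_of_ae (Lp.coeFn_smul c f)) }
    (ν s ^ (1 / (1 : ℝ≥0∞).toReal - 1 / p.toReal)).toReal fun f => by
      have hpe : 0 ≤ 1 / (1 : ℝ≥0∞).toReal - 1 / p.toReal := by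
        rcases eq_or_ne p ∞ with rfl | hp
        · simp
        have h1 : 1 ≤ p.toReal := by
          rw [← ENNReal.toReal_one]
          exact ENNReal.toReal_mono hp Fact.out
        rw [ENNReal.toReal_one, div_one, sub_nonneg]
        exact (div_le_one (by linarith)).2 h1
      have hfin : ν s ^ (1 / (1 : ℝ≥0∞).toReal - 1 / p.toReal) ≠ ∞ :=
        ENNReal.rpow_ne_top_of_nonneg hpe hs
      change ‖∫ x in s, f x ∂ν‖ ≤ _
      refine (norm_integral_le_lintegral_norm _).trans ?_
      rw [Lp.norm_def, ← ENNReal.toReal_mul]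
      refine ENNReal.toReal_mono (ENNReal.mul_ne_top hfin (Lp.eLpNorm_ne_top f)) ?_
      simp only [ofReal_norm]
      rw [← eLpNorm_one_eq_lintegral_enorm, mul_comm]
      refine (eLpNorm_le_eLpNorm_mul_rpow_measure_univ (Fact.out : 1 ≤ p)
        (Lp.aestronglyMeasurable f).restrict).trans ?_
      rw [Measure.restrict_apply_univ]
      gcongr
      exact Measure.restrict_le_self

theorem setIntegralLp_apply {s : Set α} (hs : ν s ≠ ∞) (f : Lp 𝕜 p ν) :
    setIntegralLp hs f = ∫ x in s, f x ∂ν := rfl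

end

theorem mul_eq_zero_of_notMem_tsupport_mul {G 𝕜 : Type*} [Group G] [TopologicalSpace G]
    [RCLike 𝕜] {k f : G → 𝕜} {x : G}
    (hx : x ∉ tsupport k * tsupport f) (y : G) : k y * f (y⁻¹ * x) = 0 := by
  by_contra hne
  obtain ⟨h1, h2⟩ := mul_ne_zero_iff.1 hne
  exact hx ⟨y, subset_tsupport _ h1, y⁻¹ * x, subset_tsupport _ h2, by simp⟩

theorem hasCompactSupport_groupConv {G 𝕜 : Type*} [Group G] [TopologicalSpace G]
    [IsTopologicalGroup G] [T2Space G] [MeasurableSpace G] {ν : Measure G} [RCLike 𝕜] {k f : G → 𝕜}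
    (hks : HasCompactSupport k) (hfs : HasCompactSupport f) : HasCompactSupport (groupConv ν k f) :=
  HasCompactSupport.intro (IsCompact.mul hks hfs) fun x hx => by
    simp [groupConv, mul_eq_zero_of_notMem_tsupport_mul hx]

variable {G : Type*} [Group G] [TopologicalSpace G] [IsTopologicalGroup G]
  [MeasurableSpace G] [BorelSpace G] {ν : Measure G}
  {𝕜 : Type*} [RCLike 𝕜] {p : ℝ≥0∞} [Fact (1 ≤ p)]

theorem continuous_groupConv [IsFiniteMeasureOnCompacts ν] {k f : G → 𝕜} (hk : Continuous k)
    (hks : HasCompactSupport k) (hf : Continuous f) : Continuous (groupConv ν k f) := by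
  rw [← continuousOn_univ]
  refine continuousOn_integral_of_compact_support (k := tsupport k) hks
    (Continuous.continuousOn ?_) fun x y _ hy => ?_
  · simp only [Function.uncurry_def]
    fun_prop
  · rw [image_eq_zero_of_notMem_tsupport hy, zero_mul]

variable [LocallyCompactSpace G] [T2Space G] [ν.Regular]

theorem integrable_mul_comp_inv_mul {k f : G → 𝕜} (hk : Integrable k ν) (hf : Continuous f)
    (hfs : HasCompactSupport f) (x : G) : Integrable (fun y => k y * f (y⁻¹ * x)) ν := by
  obtain ⟨C, hC⟩ := hfs.exists_bound_of_continuous hf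
  exact hk.smul_continuous_of_bounded (v := fun y => f (y⁻¹ * x)) (by fun_prop) fun y => hC _

variable [ν.IsHaarMeasure]

theorem convOp_toLp_ae_eq_groupConv_of_continuous (hp : p ≠ ∞) {k f : G → 𝕜} (hk : Continuous k)
    (hks : HasCompactSupport k) (hki : Integrable k ν) (hf : Continuous f)
    (hfs : HasCompactSupport f) (hfm : MemLp f p ν) :
    convOp hp hki (hfm.toLp f) =ᵐ[ν] groupConv ν k f := by
  have hm : MemLp (groupConv ν k f) p ν :=
    (continuous_groupConv hk hks hf).memLp_of_hasCompactSupport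
      (hasCompactSupport_groupConv hks hfs)
  refine EventuallyEq.trans ?_ hm.coeFn_toLp
  -- over a set of finite measure the integrals agree by Fubini for continuous functions of compact
  -- support, which does not need `σ`-finiteness
  refine Lp.ae_eq_of_forall_setIntegral_eq _ _ (zero_lt_one.trans_le Fact.out).ne' hp
    (fun s _ hs => integrableOn_Lp_of_measure_ne_top _ Fact.out hs.ne)
    (fun s _ hs => integrableOn_Lp_of_measure_ne_top _ Fact.out hs.ne) fun s hs hsν => ?_
  rw [integral_congr_ae (ae_restrict_of_ae hm.coeFn_toLp), ← setIntegralLp_apply hsν.ne,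
    convOp_apply, ← ContinuousLinearMap.integral_comp_comm _
      (integrable_smul_leftTranslation hp hki _)]
  have h1 : ∀ y, setIntegralLp hsν.ne (k y • leftTranslation 𝕜 ν y (hfm.toLp f)) =
      ∫ x in s, k y * f (y⁻¹ * x) ∂ν := fun y => by
    rw [map_smul, setIntegralLp_apply, leftTranslation_toLp, smul_eq_mul, ← integral_const_mul]
    refine integral_congr_ae (ae_restrict_of_ae ?_)
    filter_upwards [(hfm.comp_measurePreserving (measurePreserving_mul_left ν y⁻¹)).coeFn_toLp]
      with x hx
    exact congrArg (k y * ·) hx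
  simp only [h1]
  refine integral_integral_swap_of_hasCompactSupport (f := fun y x => k y * f (y⁻¹ * x)) ?_ ?_
  · simp only [Function.uncurry_def]
    fun_prop
  · refine HasCompactSupport.intro (IsCompact.prod hks (IsCompact.mul hks hfs)) fun z hz => ?_
    by_cases h2 : z.2 ∈ tsupport k * tsupport f
    · have h3 : z.1 ∉ tsupport k := fun h => hz ⟨h, h2⟩
      simp [Function.uncurry_def, image_eq_zero_of_notMem_tsupport h3]
    · exact mul_eq_zero_of_notMem_tsupport_mul h2 z.1

/-- The Bochner integral `∫ k(y) L_y f dν(y)` in `L^p(G)` is represented by the convolution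
`x ↦ ∫ k(y) f(y⁻¹ x) dν(y)`. The function `(x, y) ↦ f (y⁻¹ x)` need not be measurable for the
product `σ`-algebra; this is why `f`, and in a first step `k`, is continuous of compact support. -/
theorem convOp_toLp_ae_eq_groupConv (hp : p ≠ ∞) {k f : G → 𝕜} (hk : Integrable k ν)
    (hf : Continuous f) (hfs : HasCompactSupport f) (hfm : MemLp f p ν) :
    convOp hp hk (hfm.toLp f) =ᵐ[ν] groupConv ν k f := by
  obtain ⟨κ, hκc, hκs, hκ, -⟩ := exists_seq_continuous_hasCompactSupport_tendsto hk
  obtain ⟨C, hC⟩ := hfs.exists_bound_of_continuous hf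
  have hκi : ∀ n, Integrable (κ n) ν := fun n => (hκc n).integrable_of_hasCompactSupport (hκs n)
  have h1 : Tendsto (fun n => convOp hp (hκi n) (hfm.toLp f)) atTop
      (𝓝 (convOp hp hk (hfm.toLp f))) := by
    rw [tendsto_iff_norm_sub_tendsto_zero]
    refine squeeze_zero (fun n => norm_nonneg _) (fun n => ?_)
      (by simpa only [zero_mul] using hκ.mul_const ‖hfm.toLp f‖)
    rw [norm_sub_rev, ← convOp_sub hp hk (hκi n) (hfm.toLp f)]
    exact norm_convOp_le (E := 𝕜) hp (hk.sub (hκi n)) (hfm.toLp f)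
  have h2 : ∀ x, Tendsto (fun n => groupConv ν (κ n) f x) atTop (𝓝 (groupConv ν k f x)) := by
    intro x
    rw [tendsto_iff_norm_sub_tendsto_zero]
    refine squeeze_zero (fun n => norm_nonneg _) (fun n => ?_) (by simpa using hκ.mul_const C)
    have h4 : groupConv ν k f x - groupConv ν (κ n) f x =
        ∫ y, (k y * f (y⁻¹ * x) - κ n y * f (y⁻¹ * x)) ∂ν :=
      (integral_sub (integrable_mul_comp_inv_mul hk hf hfs x)
        (integrable_mul_comp_inv_mul (hκi n) hf hfs x)).symm
    rw [norm_sub_rev, h4, ← integral_mul_const]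
    have h3 : Integrable (fun y => ‖k y - κ n y‖ * C) ν := (hk.sub (hκi n)).norm.mul_const C
    refine norm_integral_le_of_norm_le h3 (Eventually.of_forall fun y => ?_)
    rw [← sub_mul, norm_mul]
    exact mul_le_mul_of_nonneg_left (hC _) (norm_nonneg _)
  obtain ⟨ns, hns, hae⟩ := (tendstoInMeasure_of_tendsto_Lp h1).exists_seq_tendsto_ae
  filter_upwards [hae, ae_all_iff.2 fun n => convOp_toLp_ae_eq_groupConv_of_continuous hp (hκc n)
    (hκs n) (hκi n) hf hfs hfm] with x hx1 hx2
  simp only [hx2] at hx1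
  exact tendsto_nhds_unique hx1 ((h2 x).comp hns.tendsto_atTop)

end Pointwise

/-! ### The maximal inequality for functions with values in `L^p(Ω)` -/

section VectorValued

/-- Tonelli's theorem without `σ`-finiteness, for an integrand that depends on one of the variables
through a simple function only. -/
theorem lintegral_lintegral_simpleFunc_swap {α Ω τ : Type*} [MeasurableSpace α]
    [MeasurableSpace Ω] {ν : Measure α} {μ : Measure Ω} (s : SimpleFunc Ω τ) {J : α → τ → ℝ≥0∞}
    (hJ : ∀ t, AEMeasurable (fun x => J x t) ν) :
    ∫⁻ x, ∫⁻ ω, J x (s ω) ∂μ ∂ν = ∫⁻ ω, ∫⁻ x, J x (s ω) ∂ν ∂μ := by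
  have h1 : ∀ g : τ → ℝ≥0∞, ∫⁻ ω, g (s ω) ∂μ = ∑ t ∈ s.range, g t * μ (s ⁻¹' {t}) := fun g => by
    rw [← SimpleFunc.map_lintegral, ← SimpleFunc.lintegral_eq_lintegral, SimpleFunc.coe_map]
    rfl
  rw [h1 fun t => ∫⁻ x, J x t ∂ν]
  simp only [h1]
  rw [lintegral_finsetSum' _ fun t _ => (hJ t).mul_const _]
  exact Finset.sum_congr rfl fun t _ => lintegral_mul_const'' _ (hJ t)

theorem enorm_rpow_eq_lintegral {α Z : Type*} [MeasurableSpace α] {ν : Measure α}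
    [NormedAddCommGroup Z] {p : ℝ≥0∞} [Fact (1 ≤ p)] (hp : p ≠ ∞) (F : Lp Z p ν) :
    ‖F‖ₑ ^ p.toReal = ∫⁻ x, ‖F x‖ₑ ^ p.toReal ∂ν := by
  have hp0 : p ≠ 0 := (zero_lt_one.trans_le Fact.out).ne'
  rw [Lp.enorm_def, eLpNorm_eq_lintegral_rpow_enorm_toReal hp0 hp, ← ENNReal.rpow_mul,
    one_div_mul_cancel (ENNReal.toReal_pos hp0 hp).ne', ENNReal.rpow_one]

theorem enorm_eq_iSup_enorm {ι E : Type*} [Fintype ι] [SeminormedAddCommGroup E] (f : ι → E) :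
    ‖f‖ₑ = ⨆ i, ‖f i‖ₑ := by
  rw [enorm_eq_nnnorm, Pi.nnnorm_def, ENNReal.coe_finset_sup, Finset.sup_univ_eq_iSup]
  rfl

section Tensor

variable {α 𝕜 E : Type*} [RCLike 𝕜] [MeasurableSpace α] {ν : Measure α} [NormedAddCommGroup E]
  [NormedSpace 𝕜 E] {p : ℝ≥0∞} [Fact (1 ≤ p)]

/-- The elementary tensor `f ⊗ e`, that is `x ↦ f(x) e`, in `L^p(α; E)`. -/
noncomputable def lpTensor (e : E) : Lp 𝕜 p ν →L[𝕜] Lp E p ν :=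
  ContinuousLinearMap.compLpL p ν (ContinuousLinearMap.toSpanSingleton 𝕜 e)

theorem lpTensor_coeFn (e : E) (f : Lp 𝕜 p ν) : lpTensor e f =ᵐ[ν] fun x => f x • e :=
  ContinuousLinearMap.coeFn_compLpL _ f

theorem continuous_lpTensor_left (f : Lp 𝕜 p ν) : Continuous fun e : E => lpTensor e f := by
  let A : E →+ Lp E p ν := AddMonoidHom.mk' (fun e => lpTensor e f) fun e e' => by
    refine Lp.ext ?_
    filter_upwards [lpTensor_coeFn (e + e') f, lpTensor_coeFn e f, lpTensor_coeFn e' f,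
      Lp.coeFn_add (lpTensor e f) (lpTensor e' f)] with x h1 h2 h3 h4
    rw [h1, h4, Pi.add_apply, h2, h3, smul_add]
  refine AddMonoidHomClass.continuous_of_bound A ‖f‖ fun e => ?_
  refine (ContinuousLinearMap.norm_compLp_le _ _).trans ?_
  rw [ContinuousLinearMap.norm_toSpanSingleton, mul_comm]

end Tensor

variable {G Ω 𝕜 : Type*} [RCLike 𝕜] [MeasurableSpace Ω] {μ : Measure Ω} {p : ℝ≥0∞} [Fact (1 ≤ p)]

section Dense

variable [TopologicalSpace G] [LocallyCompactSpace G] [T2Space G] [MeasurableSpace G]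
  [BorelSpace G] {ν : Measure G} [ν.Regular]

/-- Finite sums of tensors `f ⊗ e`, with `f` continuous of compact support and `e` a simple
function, are dense in `L^p(G; L^p(Ω))`. -/
theorem mem_closure_span_lpTensor (hp : p ≠ ∞) (F : Lp (Lp 𝕜 p μ) p ν) :
    F ∈ (Submodule.span 𝕜 {H : Lp (Lp 𝕜 p μ) p ν | ∃ (f : G → 𝕜) (hf : MemLp f p ν)
      (e : Lp.simpleFunc 𝕜 p μ), Continuous f ∧ HasCompactSupport f ∧
        H = lpTensor (e : Lp 𝕜 p μ) (hf.toLp f)}).topologicalClosure := by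
  set V := Submodule.span 𝕜 {H : Lp (Lp 𝕜 p μ) p ν | ∃ (f : G → 𝕜) (hf : MemLp f p ν)
      (e : Lp.simpleFunc 𝕜 p μ), Continuous f ∧ HasCompactSupport f ∧
        H = lpTensor (e : Lp 𝕜 p μ) (hf.toLp f)} with hV
  have hVc : IsClosed (V.topologicalClosure : Set (Lp (Lp 𝕜 p μ) p ν)) :=
    V.isClosed_topologicalClosure
  have h1 : ∀ (e : Lp.simpleFunc 𝕜 p μ) (f : Lp 𝕜 p ν),
      lpTensor (e : Lp 𝕜 p μ) f ∈ V.topologicalClosure := by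
    intro e f
    have hd : f ∈ closure {g : Lp 𝕜 p ν | ∃ (g' : G → 𝕜) (hg : MemLp g' p ν), Continuous g' ∧
        HasCompactSupport g' ∧ g = hg.toLp g'} := by
      refine EMetric.mem_closure_iff.2 fun ε hε => ?_
      obtain ⟨g', hg, hgc, hgs⟩ :=
        (Lp.memLp f).exists_continuous_hasCompactSupport_eLpNorm_sub_le hp
          (ENNReal.half_pos (lt_min hε one_pos).ne').ne'
      have hgm : MemLp g' p ν := hgc.memLp_of_hasCompactSupport hgs
      refine ⟨hgm.toLp g', ⟨g', hgm, hgc, hgs, rfl⟩, ?_⟩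
      rw [Lp.edist_def]
      have h2 : eLpNorm (⇑f - ⇑(hgm.toLp g')) p ν = eLpNorm (⇑f - g') p ν :=
        eLpNorm_congr_ae ((ae_eq_refl _).sub hgm.coeFn_toLp)
      rw [h2]
      refine hg.trans_lt (lt_of_lt_of_le (ENNReal.half_lt_self (lt_min hε one_pos).ne' ?_)
        (min_le_left _ _))
      exact ((min_le_right _ _).trans_lt ENNReal.one_lt_top).ne
    have h2 := map_mem_closure (lpTensor (e : Lp 𝕜 p μ)).continuous hd
      (t := (V.topologicalClosure : Set (Lp (Lp 𝕜 p μ) p ν))) ?_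
    · rwa [hVc.closure_eq] at h2
    · rintro _ ⟨g', hg, hgc, hgs, rfl⟩
      exact V.le_topologicalClosure (Submodule.subset_span ⟨g', hg, e, hgc, hgs, rfl⟩)
  have h2 : ∀ (e : Lp 𝕜 p μ) (f : Lp 𝕜 p ν), lpTensor e f ∈ V.topologicalClosure := fun e f =>
    (Lp.simpleFunc.denseRange hp).induction_on (p := fun e => lpTensor e f ∈ V.topologicalClosure)
      e (hVc.preimage (continuous_lpTensor_left f)) fun e => h1 e f
  refine Lp.induction hp (motive := fun F => F ∈ V.topologicalClosure) ?_ ?_ hVc F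
  · intro c s hs hνs
    have h3 : (Lp.simpleFunc.indicatorConst p hs hνs.ne c : Lp (Lp 𝕜 p μ) p ν) =
        lpTensor c (indicatorConstLp p hs hνs.ne (1 : 𝕜)) := by
      rw [Lp.simpleFunc.coe_indicatorConst]
      refine Lp.ext ?_
      filter_upwards [lpTensor_coeFn c (indicatorConstLp p hs hνs.ne (1 : 𝕜)),
        indicatorConstLp_coeFn (p := p) (hs := hs) (hμs := hνs.ne) (c := c),
        indicatorConstLp_coeFn (p := p) (hs := hs) (hμs := hνs.ne) (c := (1 : 𝕜))] with x h3 h4 h5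
      rw [h3, h4, h5]
      by_cases hx : x ∈ s <;> simp [hx]
    rw [h3]
    exact h2 _ _
  · exact fun f g hf hg _ h3 h4 => add_mem h3 h4

end Dense

variable [Group G] [TopologicalSpace G] [IsTopologicalGroup G] [LocallyCompactSpace G]
  [T2Space G] [MeasurableSpace G] [BorelSpace G] {ν : Measure G} [ν.IsHaarMeasure] [ν.Regular]

theorem convOp_lpTensor (hp : p ≠ ∞) {k : G → 𝕜} (hk : Integrable k ν) (e : Lp 𝕜 p μ)
    (f : Lp 𝕜 p ν) : convOp hp hk (lpTensor e f) = lpTensor e (convOp hp hk f) := by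
  rw [convOp_apply, convOp_apply, ← ContinuousLinearMap.integral_comp_comm _
    (integrable_smul_leftTranslation hp hk f)]
  congr 1
  ext1 y
  rw [map_smul]
  congr 1
  refine Lp.ext ?_
  filter_upwards [leftTranslation_coeFn (𝕜 := 𝕜) ν y (lpTensor e f),
    (measurePreserving_mul_left ν y⁻¹).quasiMeasurePreserving.ae (lpTensor_coeFn e f),
    lpTensor_coeFn e (leftTranslation 𝕜 ν y f), leftTranslation_coeFn (𝕜 := 𝕜) ν y f]
    with x h1 h2 h3 h4
  rw [h1, h2, h3, h4]

/-- The operator `F ↦ (k₁ ⋆ F, …, k_N ⋆ F)`; the norm of its value at `F` is the norm, in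
`L^p(G × Ω)`, of the maximal function of `F`. -/
noncomputable def convTuple (hp : p ≠ ∞) {k : ℕ → G → 𝕜} (hk : ∀ i, Integrable (k i) ν) (N : ℕ) :
    Lp (Lp 𝕜 p μ) p ν →L[𝕜] Lp (Lp (Fin N → 𝕜) p μ) p ν :=
  (lpCombine (lpTuple (𝕜 := 𝕜) (μ := μ) (p := p) (N := N))).comp
    (ContinuousLinearMap.pi fun i : Fin N => convOp hp (hk i))

theorem convTuple_apply (hp : p ≠ ∞) {k : ℕ → G → 𝕜} (hk : ∀ i, Integrable (k i) ν) (N : ℕ)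
    (F : Lp (Lp 𝕜 p μ) p ν) :
    convTuple hp hk N F = lpCombine (lpTuple (𝕜 := 𝕜) (μ := μ) (p := p))
      fun i : Fin N => convOp hp (hk i) F := rfl

/-- On finite sums of tensors the maximal inequality on `L^p(G)` is applied for each fixed `ω`, and
integrated over `ω`. As `ω` enters only through a simple function, the two integrals can be
exchanged without any `σ`-finiteness. -/
theorem enorm_convTuple_sum_lpTensor_le (hp : p ≠ ∞) {k : ℕ → G → 𝕜}
    (hk : ∀ i, Integrable (k i) ν) {mk : ℝ≥0}
    (hm : ∀ f : G → 𝕜, MemLp f p ν → eLpNorm (convMaximal ν k f) p ν ≤ mk * eLpNorm f p ν)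
    {n : ℕ} {f : Fin n → G → 𝕜} (hf : ∀ j, MemLp (f j) p ν) (hfc : ∀ j, Continuous (f j))
    (hfs : ∀ j, HasCompactSupport (f j)) (e : Fin n → Lp.simpleFunc 𝕜 p μ) (N : ℕ) :
    ‖convTuple hp hk N (∑ j, lpTensor (e j : Lp 𝕜 p μ) ((hf j).toLp (f j)))‖ₑ ≤
      mk * ‖∑ j, lpTensor (e j : Lp 𝕜 p μ) ((hf j).toLp (f j))‖ₑ := by
  have hp0 : p ≠ 0 := (zero_lt_one.trans_le Fact.out).ne'
  have hq0 : 0 < p.toReal := ENNReal.toReal_pos hp0 hp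
  set F : Lp (Lp 𝕜 p μ) p ν := ∑ j, lpTensor (e j : Lp 𝕜 p μ) ((hf j).toLp (f j)) with hF
  -- all the simple functions `e j` at once
  let s : SimpleFunc Ω (Fin n → 𝕜) :=
    { toFun := fun ω j => Lp.simpleFunc.toSimpleFunc (e j) ω
      measurableSet_fiber' := fun t => by
        have : (fun ω j => Lp.simpleFunc.toSimpleFunc (e j) ω) ⁻¹' {t} =
            ⋂ j, Lp.simpleFunc.toSimpleFunc (e j) ⁻¹' {t j} := by
          ext ω
          simp [funext_iff]
        rw [this]
        exact MeasurableSet.iInter fun j => SimpleFunc.measurableSet_fiber _ _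
      finite_range' := by
        refine (Set.Finite.pi' fun j => (Lp.simpleFunc.toSimpleFunc (e j)).finite_range).subset ?_
        rintro _ ⟨ω, rfl⟩ j
        exact ⟨ω, rfl⟩ }
  have hs : ∀ᵐ ω ∂μ, ∀ j, (e j : Lp 𝕜 p μ) ω = s ω j :=
    ae_all_iff.2 fun j => (Lp.simpleFunc.toSimpleFunc_eq_toFun (e j)).symm
  have hcomb : ∀ c : Fin n → 𝕜, ∀ᵐ ω ∂μ,
      (∑ j, c j • (e j : Lp 𝕜 p μ) : Lp 𝕜 p μ) ω = ∑ j, c j * s ω j := fun c => by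
    filter_upwards [hs, Lp.coeFn_finsetSum Finset.univ fun j => c j • (e j : Lp 𝕜 p μ),
      ae_all_iff.2 fun j => Lp.coeFn_smul (c j) (e j : Lp 𝕜 p μ)] with ω h1 h2 h3
    rw [h2, Finset.sum_apply]
    exact Finset.sum_congr rfl fun j _ => by rw [h3 j, Pi.smul_apply, h1, smul_eq_mul]
  have hFx : ∀ᵐ x ∂ν, F x = ∑ j, f j x • (e j : Lp 𝕜 p μ) := by
    filter_upwards [Lp.coeFn_finsetSum Finset.univ fun j =>
        lpTensor (e j : Lp 𝕜 p μ) ((hf j).toLp (f j)),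
      ae_all_iff.2 fun j => lpTensor_coeFn (e j : Lp 𝕜 p μ) ((hf j).toLp (f j)),
      ae_all_iff.2 fun j => (hf j).coeFn_toLp] with x h1 h2 h3
    rw [hF, h1, Finset.sum_apply]
    exact Finset.sum_congr rfl fun j _ => by rw [h2 j, h3 j]
  have hconv : ∀ i : ℕ, ∀ᵐ x ∂ν, convOp hp (hk i) F x =
      ∑ j, groupConv ν (k i) (f j) x • (e j : Lp 𝕜 p μ) := fun i => by
    rw [hF, map_sum]
    simp only [convOp_lpTensor]
    filter_upwards [Lp.coeFn_finsetSum Finset.univ fun j =>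
        lpTensor (e j : Lp 𝕜 p μ) (convOp hp (hk i) ((hf j).toLp (f j))),
      ae_all_iff.2 fun j =>
        lpTensor_coeFn (e j : Lp 𝕜 p μ) (convOp hp (hk i) ((hf j).toLp (f j))),
      ae_all_iff.2 fun j => convOp_toLp_ae_eq_groupConv hp (hk i) (hfc j) (hfs j) (hf j)]
      with x h1 h2 h3
    rw [h1, Finset.sum_apply]
    exact Finset.sum_congr rfl fun j _ => by rw [h2 j, h3 j]
  have hgm : ∀ i j, AEStronglyMeasurable (groupConv ν (k i) (f j)) ν := fun i j =>
    (Lp.aestronglyMeasurable _).congr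
      (convOp_toLp_ae_eq_groupConv hp (hk i) (hfc j) (hfs j) (hf j))
  have hlin : ∀ (t : Fin n → 𝕜) (i : ℕ) (x : G), ∑ j, groupConv ν (k i) (f j) x * t j =
      groupConv ν (k i) (fun x => ∑ j, f j x * t j) x := fun t i x => by
    simp only [groupConv, Finset.mul_sum, ← mul_assoc]
    rw [integral_finsetSum _ fun j _ =>
      (integrable_mul_comp_inv_mul (hk i) (hfc j) (hfs j) x).mul_const _]
    exact Finset.sum_congr rfl fun j _ => (integral_mul_const _ _).symm
  have hmem : ∀ t : Fin n → 𝕜, MemLp (fun x => ∑ j, f j x * t j) p ν := fun t =>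
    memLp_finsetSum _ fun j _ => (hf j).mul_const (t j)
  -- the powers of the two sides, as iterated integrals
  have hL : ‖convTuple hp hk N F‖ₑ ^ p.toReal = ∫⁻ x, ∫⁻ ω,
        ‖fun i : Fin N => ∑ j, groupConv ν (k i) (f j) x * s ω j‖ₑ ^ p.toReal ∂μ ∂ν := by
    rw [convTuple_apply, enorm_rpow_eq_lintegral hp]
    refine lintegral_congr_ae ?_
    filter_upwards [lpCombine_coeFn (lpTuple (𝕜 := 𝕜) (μ := μ) (p := p)) fun i : Fin N =>
      convOp hp (hk i) F, ae_all_iff.2 hconv] with x h1 h2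
    rw [h1, enorm_rpow_eq_lintegral hp]
    refine lintegral_congr_ae ?_
    filter_upwards [lpTuple_coeFn fun i : Fin N => convOp hp (hk i) F x,
      ae_all_iff.2 fun i : ℕ => hcomb fun j => groupConv ν (k i) (f j) x] with ω h3 h4
    rw [h3]
    simp only [h2, h4]
  have hR : ‖F‖ₑ ^ p.toReal = ∫⁻ x, ∫⁻ ω, ‖∑ j, f j x * s ω j‖ₑ ^ p.toReal ∂μ ∂ν := by
    rw [enorm_rpow_eq_lintegral hp]
    refine lintegral_congr_ae ?_
    filter_upwards [hFx] with x h1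
    rw [h1, enorm_rpow_eq_lintegral hp]
    refine lintegral_congr_ae ?_
    filter_upwards [hcomb fun j => f j x] with ω h2
    rw [h2]
  rw [← ENNReal.rpow_le_rpow_iff hq0, ENNReal.mul_rpow_of_nonneg _ _ hq0.le, hL, hR,
    lintegral_lintegral_simpleFunc_swap s
      (J := fun x t => ‖fun i : Fin N => ∑ j, groupConv ν (k i) (f j) x * t j‖ₑ ^ p.toReal) ?_,
    lintegral_lintegral_simpleFunc_swap s (J := fun x t => ‖∑ j, f j x * t j‖ₑ ^ p.toReal)
      fun t => (hmem t).aestronglyMeasurable.enorm.pow_const _,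
    ← lintegral_const_mul' _ _ (ENNReal.rpow_ne_top_of_nonneg hq0.le ENNReal.coe_ne_top)]
  · refine lintegral_mono fun ω => ?_
    have h1 := ENNReal.rpow_le_rpow (hm _ (hmem (s ω))) hq0.le
    rw [ENNReal.mul_rpow_of_nonneg _ _ hq0.le, eLpNorm_eq_lintegral_rpow_enorm_toReal hp0 hp,
      eLpNorm_eq_lintegral_rpow_enorm_toReal hp0 hp, ← ENNReal.rpow_mul, ← ENNReal.rpow_mul,
      one_div_mul_cancel hq0.ne', ENNReal.rpow_one, ENNReal.rpow_one] at h1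
    refine le_trans (lintegral_mono fun x => ?_) h1
    refine ENNReal.rpow_le_rpow ?_ hq0.le
    rw [enorm_eq_self]
    simp only [hlin]
    rw [enorm_eq_iSup_enorm]
    exact iSup_le fun i =>
      le_iSup (fun i => ‖groupConv ν (k i) (fun x => ∑ j, f j x * s ω j) x‖ₑ) (i : ℕ)
  · intro t
    refine AEMeasurable.pow_const (AEStronglyMeasurable.enorm ?_) _
    refine (aemeasurable_pi_lambda _ fun i => ?_).aestronglyMeasurable
    exact Finset.aemeasurable_fun_sum _ fun j _ => (hgm i j).aemeasurable.mul_const _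

/-- The maximal inequality on `L^p(G)` carries over to functions with values in `L^p(Ω)`. -/
theorem norm_convTuple_le (hp : p ≠ ∞) {k : ℕ → G → 𝕜}
    (hk : ∀ i, Integrable (k i) ν) {mk : ℝ≥0}
    (hm : ∀ f : G → 𝕜, MemLp f p ν → eLpNorm (convMaximal ν k f) p ν ≤ mk * eLpNorm f p ν)
    (F : Lp (Lp 𝕜 p μ) p ν) (N : ℕ) :
    ‖convTuple hp hk N F‖ ≤ mk * ‖F‖ := by
  have hcl : IsClosed {F : Lp (Lp 𝕜 p μ) p ν | ‖convTuple hp hk N F‖ ≤ mk * ‖F‖} :=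
    isClosed_le (convTuple hp hk N).continuous.norm (continuous_const.mul continuous_norm)
  refine closure_minimal ?_ hcl (mem_closure_span_lpTensor hp F)
  intro H hH
  obtain ⟨n, a, g, rfl⟩ := Submodule.mem_span_set'.1 hH
  choose f hf e hfc hfs hg using fun j => (g j).2
  have h1 : ∀ j, MemLp (a j • f j) p ν := fun j => (hf j).const_smul (a j)
  have h2 : ∑ j, a j • (g j : Lp (Lp 𝕜 p μ) p ν) =
      ∑ j, lpTensor (e j : Lp 𝕜 p μ) ((h1 j).toLp (a j • f j)) :=
    Finset.sum_congr rfl fun j _ => by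
      rw [hg, MemLp.toLp_const_smul (a j) (hf j), map_smul]
  have h3 := enorm_convTuple_sum_lpTensor_le (μ := μ) hp hk hm h1
    (fun j => (hfc j).const_smul (a j)) (fun j => (hfs j).smul_left) e N
  rw [← h2, ← ofReal_norm, ← ofReal_norm, ← ENNReal.ofReal_coe_nnreal,
    ← ENNReal.ofReal_mul mk.coe_nonneg] at h3
  exact (ENNReal.ofReal_le_ofReal_iff (by positivity)).1 h3

end VectorValued

/-! ### Transference along orbits -/

section Transference

variable {G Ω 𝕜 : Type*} [RCLike 𝕜] [MeasurableSpace Ω] {μ : Measure Ω} {p : ℝ≥0∞} [Fact (1 ≤ p)]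
  [Group G] [TopologicalSpace G] [IsTopologicalGroup G] [MeasurableSpace G] [BorelSpace G]
  {ν : Measure G} {π : G →* (Lp 𝕜 p μ →L[𝕜] Lp 𝕜 p μ)}

section OrbitMap

variable [IsFiniteMeasureOnCompacts ν]

theorem memLp_smul_orbit (hπ : IsSeparationPreservingRep π) (g : C_c(G, ℝ)) (h : Lp 𝕜 p μ) :
    MemLp (fun x => (g x : 𝕜) • π x⁻¹ h) p ν := by
  have h1 : Continuous fun x => π x⁻¹ h := (hπ.strongly_continuous h).comp continuous_inv
  have h2 : Continuous fun x => (g x : 𝕜) := RCLike.continuous_ofReal.comp (map_continuous g)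
  exact (h2.smul h1).memLp_of_hasCompactSupport
    (g.hasCompactSupport.comp_left (g := fun t : ℝ => (t : 𝕜)) RCLike.ofReal_zero).smul_right

variable (ν) in
/-- The weighted orbit map `h ↦ (x ↦ g(x) π(x⁻¹) h)` from `L^p(Ω)` to `L^p(G; L^p(Ω))`. It almost
intertwines `π(y)` with left translation by `y` when `g` is almost left invariant. -/
noncomputable def orbitMap (hπ : IsSeparationPreservingRep π) {C : ℝ} (hC : ∀ x, ‖π x‖ ≤ C)
    (g : C_c(G, ℝ)) (hg : MemLp g p ν) : Lp 𝕜 p μ →L[𝕜] Lp (Lp 𝕜 p μ) p ν :=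
  LinearMap.mkContinuous
    { toFun := fun h => (memLp_smul_orbit hπ g h).toLp _
      map_add' := fun h h' => by
        rw [← MemLp.toLp_add]
        congr 1
        ext1 x
        simp only [map_add, smul_add, Pi.add_apply]
      map_smul' := fun c h => by
        rw [RingHom.id_apply, ← MemLp.toLp_const_smul]
        congr 1
        ext1 x
        simp only [map_smul, Pi.smul_apply, smul_comm c] }
    (C * ‖hg.toLp g‖) fun h => by
      rw [mul_right_comm]
      refine Lp.norm_le_mul_norm_of_ae_le_mul ?_
      filter_upwards [(memLp_smul_orbit (ν := ν) hπ g h).coeFn_toLp, hg.coeFn_toLp] with x h1 h2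
      refine (congrArg norm h1).trans_le ?_
      rw [h2, norm_smul, RCLike.norm_ofReal, mul_comm, Real.norm_eq_abs]
      gcongr
      exact ((π x⁻¹).le_opNorm h).trans (by gcongr; exact hC _)

theorem orbitMap_coeFn (hπ : IsSeparationPreservingRep π) {C : ℝ} (hC : ∀ x, ‖π x‖ ≤ C)
    (g : C_c(G, ℝ)) (hg : MemLp g p ν) (h : Lp 𝕜 p μ) :
    orbitMap ν hπ hC g hg h =ᵐ[ν] fun x => (g x : 𝕜) • π x⁻¹ h :=
  (memLp_smul_orbit hπ g h).coeFn_toLp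

theorem norm_orbitMap_le (hπ : IsSeparationPreservingRep π) {C : ℝ} (hC : ∀ x, ‖π x‖ ≤ C)
    (g : C_c(G, ℝ)) (hg : MemLp g p ν) (h : Lp 𝕜 p μ) :
    ‖orbitMap ν hπ hC g hg h‖ ≤ C * ‖hg.toLp g‖ * ‖h‖ :=
  ContinuousLinearMap.le_of_opNorm_le _ (LinearMap.mkContinuous_norm_le _
    (mul_nonneg ((norm_nonneg _).trans (hC 1)) (norm_nonneg _)) _) h

/-- The intertwining relation is exact for `π` itself, since `π(x⁻¹) π(y) = π((y⁻¹ x)⁻¹)`; the only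
error comes from the weight. -/
theorem norm_orbitMap_sub_leftTranslation_le [ν.IsMulLeftInvariant]
    (hπ : IsSeparationPreservingRep π) {C : ℝ} (hC : ∀ x, ‖π x‖ ≤ C)
    (g : C_c(G, ℝ)) (hg : MemLp g p ν) (h : Lp 𝕜 p μ) (y : G) :
    ‖orbitMap ν hπ hC g hg (π y h) - leftTranslation 𝕜 ν y (orbitMap ν hπ hC g hg h)‖ ≤
      C * ‖h‖ * ‖leftTranslation ℝ ν y (hg.toLp g) - hg.toLp g‖ := by
  refine Lp.norm_le_mul_norm_of_ae_le_mul ?_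
  have hqmp := (measurePreserving_mul_left ν y⁻¹).quasiMeasurePreserving
  filter_upwards [Lp.coeFn_sub (orbitMap ν hπ hC g hg (π y h))
      (leftTranslation 𝕜 ν y (orbitMap ν hπ hC g hg h)),
    Lp.coeFn_sub (leftTranslation ℝ ν y (hg.toLp g)) (hg.toLp g),
    orbitMap_coeFn hπ hC g hg (π y h), hg.coeFn_toLp,
    leftTranslation_coeFn (𝕜 := 𝕜) ν y (orbitMap ν hπ hC g hg h),
    leftTranslation_coeFn (𝕜 := ℝ) ν y (hg.toLp g),
    hqmp.ae (orbitMap_coeFn hπ hC g hg h), hqmp.ae hg.coeFn_toLp] with x h1 h2 h3 h4 h5 h6 h7 h8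
  rw [h1, h2, Pi.sub_apply, Pi.sub_apply, h3, h4, h5, h6, h7, h8]
  have h9 : π (y⁻¹ * x)⁻¹ h = π x⁻¹ (π y h) := by
    rw [mul_inv_rev, inv_inv, map_mul, mul_apply_eq_comp]
  rw [h9, ← sub_smul, ← RCLike.ofReal_sub, norm_smul, RCLike.norm_ofReal, ← h9, mul_comm,
    ← Real.norm_eq_abs, norm_sub_rev]
  gcongr
  exact ((π _).le_opNorm h).trans (by gcongr; exact hC _)

/-- At each point `x` the operator `π(x)` undoes the `π(x⁻¹)` in the orbit map; as it preserves
separation, it does so at the cost of a factor `‖π(x)‖` for the maximal function too. -/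
theorem norm_lpTuple_mul_le (hp : p ≠ ∞) (hπ : IsSeparationPreservingRep π) {C : ℝ}
    (hC : ∀ x, ‖π x‖ ≤ C) (g : C_c(G, ℝ)) (hg : MemLp g p ν) {N : ℕ} (e : Fin N → Lp 𝕜 p μ) :
    ‖lpTuple e‖ * ‖hg.toLp g‖ ≤
      C * ‖lpCombine (lpTuple (𝕜 := 𝕜) (μ := μ) (p := p))
        fun i => orbitMap ν hπ hC g hg (e i)‖ := by
  have h0 : ‖‖lpTuple e‖ • hg.toLp g‖ = ‖lpTuple e‖ * ‖hg.toLp g‖ := by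
    rw [norm_smul, norm_norm]
  rw [← h0]
  refine Lp.norm_le_mul_norm_of_ae_le_mul ?_
  filter_upwards [Lp.coeFn_smul ‖lpTuple e‖ (hg.toLp g), hg.coeFn_toLp,
    lpCombine_coeFn (lpTuple (𝕜 := 𝕜) (μ := μ) (p := p))
      fun i => orbitMap ν hπ hC g hg (e i),
    ae_all_iff.2 fun i => orbitMap_coeFn hπ hC g hg (e i)] with x h1 h2 h3 h4
  rw [h1, Pi.smul_apply, h2, h3]
  simp only [h4]
  have h5 : (fun i => π x ((g x : 𝕜) • π x⁻¹ (e i))) = (g x : 𝕜) • e := by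
    ext1 i
    rw [map_smul, ← mul_apply_eq_comp, ← map_mul, mul_inv_cancel, map_one,
      one_apply_eq_self, Pi.smul_apply]
  have h6 := (hπ.separation_preserving x).norm_lpTuple_le hp
    fun i => (g x : 𝕜) • π x⁻¹ (e i)
  rw [h5, map_smul, norm_smul, RCLike.norm_ofReal] at h6
  rw [norm_smul, norm_norm, Real.norm_eq_abs, mul_comm]
  exact h6.trans (by gcongr; exact hC x)

end OrbitMap

variable [LocallyCompactSpace G] [T2Space G] [ν.IsHaarMeasure] [ν.Regular]

/-- The orbit map almost intertwines `π(k)` with convolution by `k`, with an error controlled by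
how far `g` is from being left invariant on average over `k`. -/
theorem norm_orbitMap_integratedRep_sub_convOp_le (hp : p ≠ ∞)
    (hπ : IsSeparationPreservingRep π) {C : ℝ} (hC : ∀ x, ‖π x‖ ≤ C) {k : G → 𝕜}
    (hk : Integrable k ν) (g : C_c(G, ℝ)) (hg : MemLp g p ν) (h : Lp 𝕜 p μ) :
    ‖orbitMap ν hπ hC g hg (integratedRep ν π k h) - convOp hp hk (orbitMap ν hπ hC g hg h)‖ ≤
      C * ‖h‖ * ∫ y, ‖k y‖ * ‖leftTranslation ℝ ν y (hg.toLp g) - hg.toLp g‖ ∂ν := by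
  set B := orbitMap ν hπ hC g hg with hB
  have hi : Integrable (fun y => k y • π y h) ν := integrable_integratedRep ν hπ hk h
  have h1 : B (integratedRep ν π k h) - convOp hp hk (B h) =
      ∫ y, k y • (B (π y h) - leftTranslation 𝕜 ν y (B h)) ∂ν := by
    have h2 := B.integrable_comp hi
    rw [integratedRep, ← B.integral_comp_comm hi, convOp_apply,
      ← integral_sub h2 (integrable_smul_leftTranslation hp hk (B h))]
    simp only [map_smul, smul_sub]
  have h3 : Integrable (fun y => ‖k y‖ *
      ‖leftTranslation ℝ ν y (hg.toLp g) - hg.toLp g‖) ν :=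
    hk.norm.smul_continuous_of_bounded (C := 2 * ‖hg.toLp g‖)
      (((continuous_leftTranslation ν hp (hg.toLp g)).sub continuous_const).norm) fun y => by
        rw [norm_norm, two_mul]
        refine (norm_sub_le _ _).trans ?_
        rw [norm_leftTranslation]
  rw [h1, ← integral_const_mul]
  refine norm_integral_le_of_norm_le (h3.const_mul (C * ‖h‖)) (Eventually.of_forall fun y => ?_)
  rw [norm_smul, mul_left_comm]
  exact mul_le_mul_of_nonneg_left (norm_orbitMap_sub_leftTranslation_le hπ hC g hg h y)
    (norm_nonneg _)

/-- The transferred inequality for finitely many kernels, with the error caused by `g` not being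
left invariant. -/
theorem norm_lpTuple_integratedRep_le_add (hp : p ≠ ∞)
    (hπ : IsSeparationPreservingRep π) {C : ℝ} (hC : ∀ x, ‖π x‖ ≤ C) {k : ℕ → G → 𝕜}
    (hk : ∀ i, Integrable (k i) ν) {mk : ℝ≥0}
    (hm : ∀ f : G → 𝕜, MemLp f p ν → eLpNorm (convMaximal ν k f) p ν ≤ mk * eLpNorm f p ν)
    (h : Lp 𝕜 p μ) (N : ℕ) (g : C_c(G, ℝ)) (hg : MemLp g p ν) (hg1 : ‖hg.toLp g‖ = 1) {δ : ℝ}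
    (hδ0 : 0 ≤ δ)
    (hδ : ∀ i : Fin N,
      ∫ y, ‖k i y‖ * ‖leftTranslation ℝ ν y (hg.toLp g) - hg.toLp g‖ ∂ν ≤ δ) :
    ‖lpTuple fun i : Fin N => integratedRep ν π (k i) h‖ ≤
      C * (mk * (C * ‖h‖) + ‖lpCombine (ν := ν) (p := p)
        (lpTuple (𝕜 := 𝕜) (μ := μ) (p := p) (N := N))‖ * (C * ‖h‖ * δ)) := by
  have hC0 : 0 ≤ C := (norm_nonneg _).trans (hC 1)
  have h1 := norm_lpTuple_mul_le hp hπ hC g hg fun i : Fin N => integratedRep ν π (k i) h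
  rw [hg1, mul_one] at h1
  have h2 : (fun i : Fin N => orbitMap ν hπ hC g hg (integratedRep ν π (k i) h)) =
      (fun i : Fin N => convOp hp (hk i) (orbitMap ν hπ hC g hg h)) + fun i : Fin N =>
        (orbitMap ν hπ hC g hg (integratedRep ν π (k i) h) -
          convOp hp (hk i) (orbitMap ν hπ hC g hg h)) := by
    ext1 i
    exact (add_sub_cancel _ _).symm
  have h3 := norm_convTuple_le hp hk hm (orbitMap ν hπ hC g hg h) N
  have h3' : ‖orbitMap ν hπ hC g hg h‖ ≤ C * ‖h‖ := by
    have := norm_orbitMap_le hπ hC g hg h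
    rwa [hg1, mul_one] at this
  have h4 := (lpCombine (ν := ν) (p := p) (lpTuple (𝕜 := 𝕜) (μ := μ) (p := p) (N := N))).le_opNorm
    fun i : Fin N => (orbitMap ν hπ hC g hg (integratedRep ν π (k i) h) -
      convOp hp (hk i) (orbitMap ν hπ hC g hg h))
  have h5 : ‖fun i : Fin N => (orbitMap ν hπ hC g hg (integratedRep ν π (k i) h) -
      convOp hp (hk i) (orbitMap ν hπ hC g hg h))‖ ≤ C * ‖h‖ * δ :=
    (pi_norm_le_iff_of_nonneg (mul_nonneg (mul_nonneg hC0 (norm_nonneg _)) hδ0)).2 fun i =>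
      (norm_orbitMap_integratedRep_sub_convOp_le hp hπ hC (hk i) g hg h).trans
        (mul_le_mul_of_nonneg_left (hδ i) (mul_nonneg hC0 (norm_nonneg _)))
  rw [h2, map_add] at h1
  exact h1.trans (mul_le_mul_of_nonneg_left ((norm_add_le _ _).trans (add_le_add
    (h3.trans (mul_le_mul_of_nonneg_left h3' mk.coe_nonneg))
    (h4.trans (mul_le_mul_of_nonneg_left h5 (norm_nonneg _))))) hC0)

/-- The transferred inequality for the maximal function of finitely many kernels. -/
theorem norm_lpTuple_integratedRep_le (hG : IsAmenableGroup G) (hp : p ≠ ∞)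
    (hπ : IsSeparationPreservingRep π) {C : ℝ} (hC : ∀ x, ‖π x‖ ≤ C) {k : ℕ → G → 𝕜}
    (hk : ∀ i, Integrable (k i) ν) {mk : ℝ≥0}
    (hm : ∀ f : G → 𝕜, MemLp f p ν → eLpNorm (convMaximal ν k f) p ν ≤ mk * eLpNorm f p ν)
    (h : Lp 𝕜 p μ) (N : ℕ) :
    ‖lpTuple fun i : Fin N => integratedRep ν π (k i) h‖ ≤ mk * C ^ 2 * ‖h‖ := by
  have hC0 : 0 ≤ C := (norm_nonneg _).trans (hC 1)
  refine le_of_forall_pos_le_add fun ε hε => ?_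
  have key := norm_lpTuple_integratedRep_le_add hp hπ hC hk hm h N
  generalize ‖lpCombine (ν := ν) (p := p) (lpTuple (𝕜 := 𝕜) (μ := μ) (p := p) (N := N))‖ = A at key
  have hδ : 0 < ε / (|C * (A * (C * ‖h‖))| + 1) := by positivity
  obtain ⟨g, hg, hg1, hgk⟩ := exists_integral_norm_mul_norm_leftTranslation_sub_le ν hG hp
    (fun i : Fin N => k i) (fun i => hk i) hδ
  have h5 : C * (A * (C * ‖h‖)) * (ε / (|C * (A * (C * ‖h‖))| + 1)) ≤ ε := by
    rw [mul_div_assoc', div_le_iff₀ (by positivity), mul_comm]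
    exact mul_le_mul_of_nonneg_left ((le_abs_self _).trans (le_add_of_nonneg_right zero_le_one))
      hε.le
  refine (key g hg hg1 hδ.le hgk).trans ?_
  linarith

end Transference

theorem mainTheorem6 {𝕜 G Ω : Type*} [RCLike 𝕜]
    [Group G] [TopologicalSpace G] [IsTopologicalGroup G] [LocallyCompactSpace G] [T2Space G]
    [MeasurableSpace G] [BorelSpace G] (hG : IsAmenableGroup G)
    (ν : Measure G) [ν.IsHaarMeasure] [ν.Regular]
    [MeasurableSpace Ω] (μ : Measure Ω)
    (p : ℝ≥0∞) [Fact (1 ≤ p)] (hp : p ≠ ∞)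
    (π : G →* (Lp 𝕜 p μ →L[𝕜] Lp 𝕜 p μ)) (hπ : IsSeparationPreservingRep π)
    (k : ℕ → G → 𝕜) (hk : ∀ i, Integrable (k i) ν)
    (mk : ℝ≥0)
    (hm : ∀ f : G → 𝕜, MemLp f p ν →
      eLpNorm (convMaximal ν k f) p ν ≤ mk * eLpNorm f p ν)
    (h : Lp 𝕜 p μ) :
    eLpNorm (repMaximal ν π k h) p μ ≤ mk * (⨆ y : G, ‖π y‖ₑ ^ 2) * ‖h‖ₑ := by
  have hp0 : p ≠ 0 := (zero_lt_one.trans_le Fact.out).ne'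
  have hq0 : 0 < p.toReal := ENNReal.toReal_pos hp0 hp
  set S : ℝ≥0∞ := ⨆ y : G, ‖π y‖ₑ with hS
  have hS2 : ⨆ y : G, ‖π y‖ₑ ^ 2 = S ^ 2 := by
    have := (ENNReal.orderIsoRpow 2 two_pos).map_iSup fun y => ‖π y‖ₑ
    simpa only [ENNReal.orderIsoRpow_apply, ENNReal.rpow_two] using this.symm
  have hSfin : S ≠ ∞ := by
    obtain ⟨C, hC⟩ := hπ.uniformly_bounded
    refine ne_top_of_le_ne_top (ENNReal.ofReal_ne_top (r := C)) (iSup_le fun y => ?_)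
    rw [← ofReal_norm]
    exact ENNReal.ofReal_le_ofReal (hC y)
  have hC : ∀ y, ‖π y‖ ≤ S.toReal := fun y => by
    rw [← toReal_enorm]
    exact ENNReal.toReal_mono hSfin (le_iSup (fun y => ‖π y‖ₑ) y)
  have hN : ∀ N : ℕ, ‖lpTuple fun i : Fin N => integratedRep ν π (k i) h‖ₑ ≤
      mk * S ^ 2 * ‖h‖ₑ := fun N => by
    have h1 := ENNReal.ofReal_le_ofReal (norm_lpTuple_integratedRep_le hG hp hπ hC hk hm h N)
    rwa [ofReal_norm, ENNReal.ofReal_mul (by positivity), ENNReal.ofReal_mul (by positivity),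
      ENNReal.ofReal_coe_nnreal, ENNReal.ofReal_pow ENNReal.toReal_nonneg,
      ENNReal.ofReal_toReal hSfin, ofReal_norm] at h1
  -- monotone convergence from finitely many kernels to all of them
  set T : ℕ → Ω → ℝ≥0∞ := fun N ω => (⨆ i : Fin N, ‖integratedRep ν π (k i) h ω‖ₑ) ^ p.toReal
    with hT
  have hTm : ∀ N, Measurable (T N) := fun N =>
    (Measurable.iSup fun i : Fin N =>
      (Lp.stronglyMeasurable (integratedRep ν π (k i) h)).enorm).pow_const _
  have hTmono : Monotone T := fun N M hNM ω =>
    ENNReal.rpow_le_rpow (iSup_le fun i => le_iSup_of_le (Fin.castLE hNM i) le_rfl) hq0.le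
  have hTN : ∀ N, ∫⁻ ω, T N ω ∂μ ≤ (mk * S ^ 2 * ‖h‖ₑ) ^ p.toReal := fun N => by
    refine le_trans (le_of_eq ?_) (ENNReal.rpow_le_rpow (hN N) hq0.le)
    rw [enorm_rpow_eq_lintegral hp]
    refine lintegral_congr_ae ?_
    filter_upwards [lpTuple_coeFn fun i : Fin N => integratedRep ν π (k i) h] with ω hω
    rw [hω, enorm_eq_iSup_enorm]
  have hle : ∀ ω, ‖repMaximal ν π k h ω‖ₑ ^ p.toReal ≤ ⨆ N, T N ω := fun ω => by
    have h1 := (ENNReal.orderIsoRpow p.toReal hq0).map_iSup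
      fun i => ‖integratedRep ν π (k i) h ω‖ₑ
    simp only [ENNReal.orderIsoRpow_apply] at h1
    rw [enorm_eq_self, repMaximal, h1]
    refine iSup_le fun i => le_iSup_of_le (i + 1) ?_
    exact ENNReal.rpow_le_rpow (le_iSup_of_le (Fin.last i) le_rfl) hq0.le
  rw [hS2, eLpNorm_eq_lintegral_rpow_enorm_toReal hp0 hp, one_div,
    ENNReal.rpow_inv_le_iff hq0]
  calc _ ≤ ∫⁻ ω, ⨆ N, T N ω ∂μ := lintegral_mono hle
    _ = ⨆ N, ∫⁻ ω, T N ω ∂μ := lintegral_iSup hTm hTmono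
    _ ≤ _ := iSup_le hTN
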